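/- Let $A,E,B,F$ be qubits and let $V:A\otimes E\to B\otimes F$ be a two-qubit unitary. For a pure environment state $|\eta\rangle\in E$ put $\mathcal N_\eta(\rho)=\operatorname{Tr}_F V(\rho\otimes|\eta\rangle\langle\eta|)V^\dagger$ and $\widetilde{\mathcal N}_\eta(\rho)=\operatorname{Tr}_B V(\rho\otimes|\eta\rangle\langle\eta|)V^\dagger$. The channel $\mathcal N_\eta$ is degradable if $\widetilde{\mathcal N}_\eta=\mathcal M\circ\mathcal N_\eta$ for some CPTP map $\mathcal M$, anti-degradable if $\mathcal N_\eta=\mathcal M\circ\widetilde{\mathcal N}_\eta$ for some CPTP map $\mathcal M$, and symmetric if it is both. Let $\mathfrak D$ (resp. $\mathfrak A$) be the set of two-qubit unitaries for which $\mathcal N_\eta$ is degradable (resp. anti-degradable) for every unit vector $|\eta\rangle$. Let $$U(\alpha_x,\alpha_y,\alpha_z)=\sum_{k=1}^4 e^{-i\lambda_k}|\Phi_k\rangle\langle\Phi_k|,$$ with $\lambda_1=\frac{\alpha_x-\alpha_y+\alpha_z}2$, $\lambda_2=\frac{-\alpha_x+\alpha_y+\alpha_z}2$, $\lambda_3=\frac{-\alpha_x-\alpha_y-\alpha_z}2$,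 $\lambda_4=\frac{\alpha_x+\alpha_y-\alpha_z}2$ and $\Phi_1=\frac{|00\rangle+|11\rangle}{\sqrt2}$, $\Phi_2=\frac{-i(|00\rangle-|11\rangle)}{\sqrt2}$, $\Phi_3=\frac{|01\rangle-|10\rangle}{\sqrt2}$, $\Phi_4=\frac{-i(|01\rangle+|10\rangle)}{\sqrt2}$. Let $\mathfrak T=\{(\alpha_x,\alpha_y,\alpha_z):\frac\pi2\ge\alpha_x\ge\alpha_y\ge\alpha_z\ge0\}$ and $\sqrt{\mathrm{SWAP}}=\frac{1+i}2\mathbb 1+\frac{1-i}2\mathrm{SWAP}$. Call two unitaries equivalent if they agree up to local (single-qubit) unitaries before and after the gate and, possibly, entrywise complex conjugation. Then: 1. For $\alpha\in\mathfrak T$, $U(\alpha)\in\mathfrak A$ if and only if $\alpha_x+\alpha_y\ge\frac\pi2$, $\alpha_y+\alpha_z\ge\frac\pi2$ and $\alpha_z+\alpha_x\ge\frac\pi2$. The set of these $\alpha$ is the (nondegenerate) tetrahedron with vertices $(\frac\pi4,\frac\pi4,\frac\pi4)$, $(\frac\pi2,\frac\pi4,\frac\pi4)$, $(\frac\pi2,\frac\pi2,0)$,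 $(\frac\pi2,\frac\pi2,\frac\pi2)$. 2. $V\mapsto\mathrm{SWAP}\cdot V$ maps $\mathfrak A$ onto $\mathfrak D$. For $\alpha\in\mathfrak T$, $\mathrm{SWAP}\cdot U(\alpha)$ is equivalent to $U(\alpha')$ with $\alpha'=(\frac\pi2-\alpha_z,\frac\pi2-\alpha_y,\frac\pi2-\alpha_x)\in\mathfrak T$. The map $\alpha\mapsto\alpha'$ takes $\{\alpha\in\mathfrak T:U(\alpha)\in\mathfrak A\}$ onto $\{\alpha\in\mathfrak T:U(\alpha)\in\mathfrak D\}$, and takes the four vertices above, in order, to $(\frac\pi4,\frac\pi4,\frac\pi4)$, $(\frac\pi4,\frac\pi4,0)$, $(\frac\pi2,0,0)$, $(0,0,0)$; the latter region is the (nondegenerate) tetrahedron with these vertices. 3. $(\frac\pi4,\frac\pi4,\frac\pi4)$ is the only $\alpha\in\mathfrak T$ with $U(\alpha)\in\mathfrak A\cap\mathfrak D$, and $U(\frac\pi4,\frac\pi4,\frac\pi4)$ equals $\sqrt{\mathrm{SWAP}}$ (a square root of $\mathrm{SWAP}$) up to a phase factor. Moreover $\sqrt{\mathrm{SWAP}}\in\mathfrak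 A\cap\mathfrak D$, and a two-qubit operator $V$ lies in $\mathfrak A\cap\mathfrak D$ if and only if it is equivalent to $\sqrt{\mathrm{SWAP}}$. For every unit vector $|\eta\rangle$ the channel induced by $\sqrt{\mathrm{SWAP}}$ is symmetric. -/

import Mathlib

open scoped Kronecker Matrix ComplexOrder

noncomputable section

/-- Operators on one qubit. -/
abbrev QubitOp : Type := Matrix (Fin 2) (Fin 2) ℂ

/-- Operators on two qubits `A ⊗ E` (input) or `B ⊗ F` (output), where `A` and `B` are the first
tensor factor, `E` and `F` the second, in the computational basis. -/
abbrev TwoQubitOp : Type := Matrix (Fin 2 × Fin 2) (Fin 2 × Fin 2) ℂ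

/-- Partial trace over the first factor `B`. -/
def traceB (X : TwoQubitOp) : QubitOp :=
  Matrix.of fun f f' => ∑ b, X (b, f) (b, f')

/-- Partial trace over the second factor `F`. -/
def traceF (X : TwoQubitOp) : QubitOp :=
  Matrix.of fun b b' => ∑ f, X (b, f) (b', f)

/-- The rank-one operator `|v⟩⟨v|`. -/
def ketbra {ι : Type} (v : ι → ℂ) : Matrix ι ι ℂ :=
  Matrix.vecMulVec v (star v)

/-- `v` is a unit vector: `⟨v|v⟩ = 1`. -/
def IsUnitKet {ι : Type} [Fintype ι] (v : ι → ℂ) : Prop :=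
  star v ⬝ᵥ v = 1

/-- The effective channel `ρ ↦ Tr_F V (ρ ⊗ |η⟩⟨η|) V†` from `A` to `B`. -/
def effChannel (V : TwoQubitOp) (η : Fin 2 → ℂ) (ρ : QubitOp) : QubitOp :=
  traceF (V * (ρ ⊗ₖ ketbra η) * Vᴴ)

/-- The complementary channel `ρ ↦ Tr_B V (ρ ⊗ |η⟩⟨η|) V†` from `A` to `F`. -/
def complChannel (V : TwoQubitOp) (η : Fin 2 → ℂ) (ρ : QubitOp) : QubitOp :=
  traceB (V * (ρ ⊗ₖ ketbra η) * Vᴴ)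

/-- The ampliation `id_k ⊗ Φ` acting on `k × k` block matrices. -/
def ampliation (k : ℕ) (Φ : QubitOp →ₗ[ℂ] QubitOp)
    (X : Matrix (Fin k × Fin 2) (Fin k × Fin 2) ℂ) :
    Matrix (Fin k × Fin 2) (Fin k × Fin 2) ℂ :=
  Matrix.of fun p q => Φ (Matrix.of fun a b => X (p.1, a) (q.1, b)) p.2 q.2

/-- Completely positive trace-preserving maps between qubits. -/
structure IsCPTP (Φ : QubitOp →ₗ[ℂ] QubitOp) : Prop where
  completelyPositive : ∀ (k : ℕ) (X : Matrix (Fin k × Fin 2) (Fin k × Fin 2) ℂ),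
    X.PosSemidef → (ampliation k Φ X).PosSemidef
  tracePreserving : ∀ X : QubitOp, (Φ X).trace = X.trace

/-- The map `N'` is obtained from `N` by CPTP post-processing. -/
def Simulates (N N' : QubitOp → QubitOp) : Prop :=
  ∃ Φ : QubitOp →ₗ[ℂ] QubitOp, IsCPTP Φ ∧ ∀ ρ : QubitOp, N' ρ = Φ (N ρ)

/-- The effective channel with environment state `η` is degradable. -/
def IsDegradableAt (V : TwoQubitOp) (η : Fin 2 → ℂ) : Prop :=
  Simulates (effChannel V η) (complChannel V η)

/-- The effective channel with environment state `η` is anti-degradable. -/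
def IsAntiDegradableAt (V : TwoQubitOp) (η : Fin 2 → ℂ) : Prop :=
  Simulates (complChannel V η) (effChannel V η)

/-- The effective channel with environment state `η` is symmetric. -/
def IsSymmetricAt (V : TwoQubitOp) (η : Fin 2 → ℂ) : Prop :=
  IsDegradableAt V η ∧ IsAntiDegradableAt V η

/-- The set of universally degradable two-qubit unitaries. -/
def univDegradable : Set TwoQubitOp :=
  {V | V ∈ Matrix.unitaryGroup (Fin 2 × Fin 2) ℂ ∧
    ∀ η : Fin 2 → ℂ, IsUnitKet η → IsDegradableAt V η}

/-- The set of universally anti-degradable two-qubit unitaries. -/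
def univAntiDegradable : Set TwoQubitOp :=
  {V | V ∈ Matrix.unitaryGroup (Fin 2 × Fin 2) ℂ ∧
    ∀ η : Fin 2 → ℂ, IsUnitKet η → IsAntiDegradableAt V η}

/-- The computational basis vector `|i j⟩`. -/
def ket (i j : Fin 2) : Fin 2 × Fin 2 → ℂ :=
  Pi.single (i, j) 1

/-- The magic basis. -/
def magicBasis : Fin 4 → (Fin 2 × Fin 2 → ℂ) :=
  ![((Real.sqrt 2 : ℝ) : ℂ)⁻¹ • (ket 0 0 + ket 1 1),
    (-Complex.I / ((Real.sqrt 2 : ℝ) : ℂ)) • (ket 0 0 - ket 1 1),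
    ((Real.sqrt 2 : ℝ) : ℂ)⁻¹ • (ket 0 1 - ket 1 0),
    (-Complex.I / ((Real.sqrt 2 : ℝ) : ℂ)) • (ket 0 1 + ket 1 0)]

/-- The phases `λ_k` as functions of `α = (α_x, α_y, α_z)`. -/
def magicPhase (α : Fin 3 → ℝ) : Fin 4 → ℝ :=
  ![(α 0 - α 1 + α 2) / 2,
    (-α 0 + α 1 + α 2) / 2,
    (-α 0 - α 1 - α 2) / 2,
    (α 0 + α 1 - α 2) / 2]

/-- `U(α_x, α_y, α_z) = ∑_k exp(-i λ_k) |Φ_k⟩⟨Φ_k|`. -/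
def canonicalU (α : Fin 3 → ℝ) : TwoQubitOp :=
  ∑ k, Complex.exp (-Complex.I * (magicPhase α k : ℂ)) • ketbra (magicBasis k)

/-- The parameter tetrahedron `π/2 ≥ α_x ≥ α_y ≥ α_z ≥ 0`. -/
def paramTetrahedron : Set (Fin 3 → ℝ) :=
  {α | α 0 ≤ Real.pi / 2 ∧ α 1 ≤ α 0 ∧ α 2 ≤ α 1 ∧ 0 ≤ α 2}

/-- The parameters in the tetrahedron whose canonical unitary lies in `S`. -/
def paramRegion (S : Set TwoQubitOp) : Set (Fin 3 → ℝ) :=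
  {α | α ∈ paramTetrahedron ∧ canonicalU α ∈ S}

/-- Vertices of the anti-degradable tetrahedron. -/
def antiVertices : Fin 4 → (Fin 3 → ℝ) :=
  ![![Real.pi / 4, Real.pi / 4, Real.pi / 4],
    ![Real.pi / 2, Real.pi / 4, Real.pi / 4],
    ![Real.pi / 2, Real.pi / 2, 0],
    ![Real.pi / 2, Real.pi / 2, Real.pi / 2]]

/-- Vertices of the degradable tetrahedron. -/
def degVertices : Fin 4 → (Fin 3 → ℝ) :=
  ![![Real.pi / 4, Real.pi / 4, Real.pi / 4],
    ![Real.pi / 4, Real.pi / 4, 0],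
    ![Real.pi / 2, 0, 0],
    ![0, 0, 0]]

/-- The gate `SWAP |i j⟩ = |j i⟩`. -/
def swapGate : TwoQubitOp :=
  Matrix.of fun p q => if p.1 = q.2 ∧ p.2 = q.1 then 1 else 0

/-- `SWAP^γ = (1 + exp(iπγ))/2 · 1 + (1 - exp(iπγ))/2 · SWAP`. -/
def swapPow (γ : ℝ) : TwoQubitOp :=
  ((1 + Complex.exp (Complex.I * Real.pi * γ)) / 2) • (1 : TwoQubitOp) +
    ((1 - Complex.exp (Complex.I * Real.pi * γ)) / 2) • swapGate

/-- The square root of `SWAP`. -/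
def sqrtSwap : TwoQubitOp := swapPow (1 / 2)

/-- `V = (a ⊗ b) W (c ⊗ d)` for single-qubit unitaries `a, b, c, d`. -/
def LocallyEquiv (V W : TwoQubitOp) : Prop :=
  ∃ a ∈ Matrix.unitaryGroup (Fin 2) ℂ, ∃ b ∈ Matrix.unitaryGroup (Fin 2) ℂ,
    ∃ c ∈ Matrix.unitaryGroup (Fin 2) ℂ, ∃ d ∈ Matrix.unitaryGroup (Fin 2) ℂ,
      V = (a ⊗ₖ b) * W * (c ⊗ₖ d)

/-- Equivalence up to local unitaries before and after the gate and entrywise complex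
conjugation. -/
def GateEquiv (V W : TwoQubitOp) : Prop :=
  LocallyEquiv V W ∨ LocallyEquiv V (W.map (starRingEnd ℂ))

/-- The action on parameters of swapping the outputs. -/
def swapParams (α : Fin 3 → ℝ) : Fin 3 → ℝ :=
  ![Real.pi / 2 - α 2, Real.pi / 2 - α 1, Real.pi / 2 - α 0]

end

/-!
# Two-qubit unitaries that are universally anti-degradable or degradable

A two-qubit gate `V` with environment state `η` gives the isometry `W = V (· ⊗ η) : A → B ⊗ F`, and
the effective channel is anti-degradable when the `B`-output can be simulated from the `F`-output
(`AntiDegrades W`). This property depends on `W` only up to local unitaries, and degradability of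
`V` is anti-degradability of `SWAP · V`, so everything reduces to one question about `W`.

In the magic basis, `SU(2) ⊗ SU(2)` and the swap generate the real orthogonal group `O(4)`
(`exists_isLocalOrSwap_magicVec_eq`: orthogonal maps are products of reflections, and a reflection
is a local unitary times the swap). Together with a Takagi factorization on the input this brings
every isometry to the real form `|0⟩ ↦ p|00⟩ + q|11⟩`, `|1⟩ ↦ r|10⟩ + s|01⟩`
(`exists_eq_kronecker_mul_schmidtForm_mul`). Such a form is anti-degradable as soon as
`(p² - q²)(r² - s²) ≤ 0`, by explicit Kraus operators (`antiDegrades_schmidtForm`). The left-hand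
side is a local invariant, the `orientation` of `W`: the determinant of the frame formed by the two
columns of `W` and their spin flips. Hence nonpositive orientation implies anti-degradability
(`antiDegrades_of_orientation_nonpos`), without knowing the normal form explicitly.

For a gate with eigenvalues `d k` on the magic basis the orientation is a combination of three
products `Re (d i * star (d j)) * Re (d k * star (d l))`, one for each pairing `ij|kl`, whose
weights are the squares of the Bloch components of `η` (`orientation_magicDiag`). If all three products
are nonpositive the gate is universally anti-degradable. Conversely, for `η = |0⟩` the isometry is
already in Schmidt form, and contractivity of classical channels makes the first product
nonpositive; local unitaries permuting the magic basis give the other two. This is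
`magicDiag_mem_univAntiDegradable_iff`. For `U(α)` the products are
`cos (α i - α j) * cos (α i + α j)`, which yields the inequalities on the parameters and the
tetrahedra.

Finally, every two-qubit unitary is locally equivalent to a magic-diagonal one
(`exists_locallyEquiv_magicDiag`), and if all three products vanish then one eigenvalue is `±i`
times each of the others, which up to local unitaries and conjugation is `√SWAP`
(`mem_inter_iff_gateEquiv_sqrtSwap`).
-/

noncomputable section

/-! ### Completely positive maps between qubits -/

theorem IsCPTP.comp {Φ Ψ : QubitOp →ₗ[ℂ] QubitOp} (hΦ : IsCPTP Φ) (hΨ : IsCPTP Ψ) :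
    IsCPTP (Φ ∘ₗ Ψ) where
  completelyPositive k X hX := hΦ.completelyPositive k _ (hΨ.completelyPositive k X hX)
  tracePreserving X := (hΦ.tracePreserving _).trans (hΨ.tracePreserving X)

/-- The map `X ↦ ∑ i, K i * X * (K i)ᴴ` with Kraus operators `K i`. -/
def krausMap {ι : Type} [Fintype ι] (K : ι → QubitOp) : QubitOp →ₗ[ℂ] QubitOp where
  toFun X := ∑ i, K i * X * (K i)ᴴ
  map_add' X Y := by simp only [Matrix.mul_add, Matrix.add_mul, Finset.sum_add_distrib]
  map_smul' c X := by
    simp only [Matrix.mul_smul, Matrix.smul_mul, Finset.smul_sum, RingHom.id_apply]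

theorem krausMap_apply {ι : Type} [Fintype ι] (K : ι → QubitOp) (X : QubitOp) :
    krausMap K X = ∑ i, K i * X * (K i)ᴴ := rfl

theorem ampliation_krausMap {ι : Type} [Fintype ι] (K : ι → QubitOp) (k : ℕ)
    (X : Matrix (Fin k × Fin 2) (Fin k × Fin 2) ℂ) :
    ampliation k (krausMap K) X =
      ∑ i, ((1 : Matrix (Fin k) (Fin k) ℂ) ⊗ₖ K i) * X *
        ((1 : Matrix (Fin k) (Fin k) ℂ) ⊗ₖ K i)ᴴ := by
  ext ⟨p, a⟩ ⟨q, b⟩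
  simp only [ampliation, krausMap_apply, Matrix.of_apply, Matrix.sum_apply, Matrix.mul_apply,
    Matrix.conjTranspose_apply, Matrix.kroneckerMap_apply, Fintype.sum_prod_type,
    Matrix.one_apply, ite_mul, one_mul, zero_mul, Finset.sum_ite_irrel, Finset.sum_const_zero,
    Finset.sum_ite_eq, Finset.mem_univ, if_true, apply_ite star, star_zero, mul_ite, mul_zero]

theorem isCPTP_krausMap {ι : Type} [Fintype ι] {K : ι → QubitOp}
    (hK : ∑ i, (K i)ᴴ * K i = 1) : IsCPTP (krausMap K) where
  completelyPositive k X hX := by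
    rw [ampliation_krausMap]
    exact Matrix.posSemidef_sum _ fun i _ => hX.mul_mul_conjTranspose_same _
  tracePreserving X := by
    rw [krausMap_apply, Matrix.trace_sum]
    calc ∑ i, (K i * X * (K i)ᴴ).trace = ∑ i, ((K i)ᴴ * K i * X).trace :=
          Finset.sum_congr rfl fun i _ => by rw [Matrix.trace_mul_cycle]
      _ = X.trace := by rw [← Matrix.trace_sum, ← Finset.sum_mul, hK, one_mul]

/-- The unitary channel `X ↦ u * X * uᴴ`. -/
theorem exists_isCPTP_conj {u : QubitOp} (hu : u ∈ Matrix.unitaryGroup (Fin 2) ℂ) :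
    ∃ Φ : QubitOp →ₗ[ℂ] QubitOp, IsCPTP Φ ∧ ∀ X, Φ X = u * X * uᴴ :=
  ⟨krausMap fun _ : Unit => u, isCPTP_krausMap (by
    simpa [Matrix.star_eq_conjTranspose] using Matrix.mem_unitaryGroup_iff'.1 hu),
    fun X => by simp [krausMap_apply]⟩

/-! ### Stinespring isometries -/

/-- The embedding `a ↦ a ⊗ η` of `A` into `A ⊗ E`. -/
def appendKet (η : Fin 2 → ℂ) : Matrix (Fin 2 × Fin 2) (Fin 2) ℂ :=
  Matrix.of fun p a => if p.1 = a then η p.2 else 0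

theorem appendKet_mul_mul_conjTranspose (η : Fin 2 → ℂ) (ρ : QubitOp) :
    appendKet η * ρ * (appendKet η)ᴴ = ρ ⊗ₖ ketbra η := by
  ext ⟨a, e⟩ ⟨a', e'⟩
  simp only [appendKet, Matrix.mul_apply, Matrix.of_apply, Matrix.conjTranspose_apply,
    Matrix.kroneckerMap_apply, ketbra, Matrix.vecMulVec_apply, ite_mul, zero_mul,
    Finset.sum_ite_eq, Finset.mem_univ, if_true, apply_ite star, star_zero, mul_ite, mul_zero,
    Pi.star_apply]
  ring

theorem kronecker_mul_appendKet (c d : QubitOp) (η : Fin 2 → ℂ) :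
    (c ⊗ₖ d) * appendKet η = appendKet (d *ᵥ η) * c := by
  ext ⟨a, e⟩ a'
  simp only [appendKet, Matrix.mul_apply, Matrix.of_apply, Matrix.kroneckerMap_apply,
    Fintype.sum_prod_type, Matrix.mulVec, dotProduct, mul_ite, mul_zero, ite_mul, zero_mul,
    Finset.sum_ite_eq, Finset.mem_univ, if_true, Finset.sum_mul]
  rw [Finset.sum_comm]
  refine Finset.sum_congr rfl fun x _ => ?_
  simp only [Finset.sum_ite_eq', Finset.mem_univ, if_true]
  ring

theorem isUnitKet_mulVec {ι : Type} [Fintype ι] [DecidableEq ι] {u : Matrix ι ι ℂ}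
    (hu : u ∈ Matrix.unitaryGroup ι ℂ) {v : ι → ℂ} (hv : IsUnitKet v) : IsUnitKet (u *ᵥ v) := by
  unfold IsUnitKet at *
  rw [Matrix.star_mulVec, ← Matrix.dotProduct_mulVec, Matrix.mulVec_mulVec,
    ← Matrix.star_eq_conjTranspose, Matrix.mem_unitaryGroup_iff'.1 hu, Matrix.one_mulVec, hv]

theorem appendKet_isometry {η : Fin 2 → ℂ} (hη : IsUnitKet η) :
    (appendKet η)ᴴ * appendKet η = 1 := by
  unfold IsUnitKet at hη
  simp only [dotProduct, Fin.sum_univ_two, Pi.star_apply] at hη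
  ext a b
  fin_cases a <;> fin_cases b <;>
    simp [appendKet, Matrix.mul_apply, Fintype.sum_prod_type] <;> exact hη

/-- For `W : A → B ⊗ F`, the channel `ρ ↦ Tr_F W ρ W†` to `B` is obtained by CPTP post-processing
from the channel `ρ ↦ Tr_B W ρ W†` to `F`. -/
def AntiDegrades (W : Matrix (Fin 2 × Fin 2) (Fin 2) ℂ) : Prop :=
  Simulates (fun ρ => traceB (W * ρ * Wᴴ)) (fun ρ => traceF (W * ρ * Wᴴ))

theorem effChannel_eq (V : TwoQubitOp) (η : Fin 2 → ℂ) :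
    effChannel V η = fun ρ => traceF (V * appendKet η * ρ * (V * appendKet η)ᴴ) := by
  funext ρ
  rw [effChannel, ← appendKet_mul_mul_conjTranspose, Matrix.conjTranspose_mul]
  simp only [Matrix.mul_assoc]

theorem complChannel_eq (V : TwoQubitOp) (η : Fin 2 → ℂ) :
    complChannel V η = fun ρ => traceB (V * appendKet η * ρ * (V * appendKet η)ᴴ) := by
  funext ρ
  rw [complChannel, ← appendKet_mul_mul_conjTranspose, Matrix.conjTranspose_mul]
  simp only [Matrix.mul_assoc]

theorem isAntiDegradableAt_iff (V : TwoQubitOp) (η : Fin 2 → ℂ) :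
    IsAntiDegradableAt V η ↔ AntiDegrades (V * appendKet η) := by
  rw [IsAntiDegradableAt, effChannel_eq, complChannel_eq, AntiDegrades]

/-! ### The swap gate -/

theorem swapGate_mul_apply {κ : Type} (X : Matrix (Fin 2 × Fin 2) κ ℂ) (i j : Fin 2) (k : κ) :
    (swapGate * X) (i, j) k = X (j, i) k := by
  fin_cases i <;> fin_cases j <;>
    simp [swapGate, Matrix.mul_apply, Fintype.sum_prod_type]

theorem swapGate_conjTranspose : swapGateᴴ = swapGate := by
  ext ⟨i, j⟩ ⟨k, l⟩
  fin_cases i <;> fin_cases j <;> fin_cases k <;> fin_cases l <;> simp [swapGate]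

theorem swapGate_mul_self : swapGate * swapGate = 1 := by
  ext ⟨i, j⟩ ⟨k, l⟩
  rw [swapGate_mul_apply]
  fin_cases i <;> fin_cases j <;> fin_cases k <;> fin_cases l <;> simp [swapGate]

theorem swapGate_mul_cancel {κ : Type} (X : Matrix (Fin 2 × Fin 2) κ ℂ) :
    swapGate * (swapGate * X) = X := by
  rw [← Matrix.mul_assoc, swapGate_mul_self, Matrix.one_mul]

theorem swapGate_mem_unitaryGroup : swapGate ∈ Matrix.unitaryGroup (Fin 2 × Fin 2) ℂ := by
  rw [Matrix.mem_unitaryGroup_iff, Matrix.star_eq_conjTranspose, swapGate_conjTranspose,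
    swapGate_mul_self]

theorem mul_swapGate_apply {κ : Type} (X : Matrix κ (Fin 2 × Fin 2) ℂ) (i j : Fin 2) (k : κ) :
    (X * swapGate) k (i, j) = X k (j, i) := by
  fin_cases i <;> fin_cases j <;>
    simp [swapGate, Matrix.mul_apply, Fintype.sum_prod_type]

theorem swapGate_mul_kronecker (a b : QubitOp) : swapGate * (a ⊗ₖ b) = (b ⊗ₖ a) * swapGate := by
  ext ⟨i, j⟩ ⟨k, l⟩
  rw [swapGate_mul_apply, mul_swapGate_apply, Matrix.kroneckerMap_apply,
    Matrix.kroneckerMap_apply, mul_comm]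

theorem traceF_swap (X : TwoQubitOp) : traceF (swapGate * X * swapGate) = traceB X := by
  ext b b'
  simp [traceF, traceB, mul_swapGate_apply, swapGate_mul_apply]

theorem traceB_swap (X : TwoQubitOp) : traceB (swapGate * X * swapGate) = traceF X := by
  ext b b'
  simp [traceF, traceB, mul_swapGate_apply, swapGate_mul_apply]

theorem isDegradableAt_iff (V : TwoQubitOp) (η : Fin 2 → ℂ) :
    IsDegradableAt V η ↔ IsAntiDegradableAt (swapGate * V) η := by
  have h : ∀ ρ : QubitOp, swapGate * V * (ρ ⊗ₖ ketbra η) * (swapGate * V)ᴴ =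
      swapGate * (V * (ρ ⊗ₖ ketbra η) * Vᴴ) * swapGate := fun ρ => by
    rw [Matrix.conjTranspose_mul, swapGate_conjTranspose]
    simp only [Matrix.mul_assoc]
  have h1 : effChannel (swapGate * V) η = complChannel V η := funext fun ρ => by
    rw [effChannel, h, traceF_swap, complChannel]
  have h2 : complChannel (swapGate * V) η = effChannel V η := funext fun ρ => by
    rw [complChannel, h, traceB_swap, effChannel]
  rw [IsDegradableAt, IsAntiDegradableAt, h1, h2]

theorem mem_univDegradable_iff (V : TwoQubitOp) :
    V ∈ univDegradable ↔ swapGate * V ∈ univAntiDegradable := by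
  have h : V ∈ Matrix.unitaryGroup (Fin 2 × Fin 2) ℂ ↔
      swapGate * V ∈ Matrix.unitaryGroup (Fin 2 × Fin 2) ℂ :=
    ⟨fun h => mul_mem swapGate_mem_unitaryGroup h, fun h => by
      simpa only [swapGate_mul_cancel] using mul_mem swapGate_mem_unitaryGroup h⟩
  simp only [univDegradable, univAntiDegradable, Set.mem_ofPred_eq, isDegradableAt_iff, h]

theorem image_swapGate_mul_univAntiDegradable :
    (fun V : TwoQubitOp => swapGate * V) '' univAntiDegradable = univDegradable := by
  ext V
  rw [mem_univDegradable_iff]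
  constructor
  · rintro ⟨V, hV, rfl⟩
    simpa only [swapGate_mul_cancel] using hV
  · exact fun h => ⟨_, h, swapGate_mul_cancel V⟩

/-! ### Local unitaries -/

theorem traceF_kronecker_conj {b f : QubitOp} (hf : f ∈ Matrix.unitaryGroup (Fin 2) ℂ)
    (X : TwoQubitOp) : traceF ((b ⊗ₖ f) * X * (b ⊗ₖ f)ᴴ) = b * traceF X * bᴴ := by
  have hf' := Matrix.mem_unitaryGroup_iff'.1 hf
  have e : ∀ i j, ∑ k, star (f k i) * f k j = (1 : QubitOp) i j := fun i j => by
    rw [← hf', Matrix.mul_apply]; rfl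
  have e00 := e 0 0
  have e01 := e 0 1
  have e10 := e 1 0
  have e11 := e 1 1
  simp [Fin.sum_univ_two] at e00 e01 e10 e11
  ext i j
  simp [traceF, Matrix.mul_apply, Fintype.sum_prod_type, Fin.sum_univ_two]
  linear_combination (b i 0 * (X (0, 0) (0, 0) * (starRingEnd ℂ) (b j 0) +
        X (0, 0) (1, 0) * (starRingEnd ℂ) (b j 1)) +
      b i 1 * (X (1, 0) (0, 0) * (starRingEnd ℂ) (b j 0) +
        X (1, 0) (1, 0) * (starRingEnd ℂ) (b j 1))) * e00 +
    (b i 0 * (X (0, 1) (0, 0) * (starRingEnd ℂ) (b j 0) +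
        X (0, 1) (1, 0) * (starRingEnd ℂ) (b j 1)) +
      b i 1 * (X (1, 1) (0, 0) * (starRingEnd ℂ) (b j 0) +
        X (1, 1) (1, 0) * (starRingEnd ℂ) (b j 1))) * e01 +
    (b i 0 * (X (0, 0) (0, 1) * (starRingEnd ℂ) (b j 0) +
        X (0, 0) (1, 1) * (starRingEnd ℂ) (b j 1)) +
      b i 1 * (X (1, 0) (0, 1) * (starRingEnd ℂ) (b j 0) +
        X (1, 0) (1, 1) * (starRingEnd ℂ) (b j 1))) * e10 +
    (b i 0 * (X (0, 1) (0, 1) * (starRingEnd ℂ) (b j 0) +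
        X (0, 1) (1, 1) * (starRingEnd ℂ) (b j 1)) +
      b i 1 * (X (1, 1) (0, 1) * (starRingEnd ℂ) (b j 0) +
        X (1, 1) (1, 1) * (starRingEnd ℂ) (b j 1))) * e11

theorem traceB_kronecker_conj {b f : QubitOp} (hb : b ∈ Matrix.unitaryGroup (Fin 2) ℂ)
    (X : TwoQubitOp) : traceB ((b ⊗ₖ f) * X * (b ⊗ₖ f)ᴴ) = f * traceB X * fᴴ := by
  rw [← traceF_swap, ← traceF_swap X, ← traceF_kronecker_conj hb]
  congr 1
  calc swapGate * ((b ⊗ₖ f) * X * (b ⊗ₖ f)ᴴ) * swapGate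
      = swapGate * (b ⊗ₖ f) * X * (swapGate * (b ⊗ₖ f))ᴴ := by
        rw [Matrix.conjTranspose_mul, swapGate_conjTranspose]
        simp only [Matrix.mul_assoc]
    _ = _ := by
        rw [swapGate_mul_kronecker, Matrix.conjTranspose_mul, swapGate_conjTranspose]
        simp only [Matrix.mul_assoc]

theorem AntiDegrades.local {W : Matrix (Fin 2 × Fin 2) (Fin 2) ℂ} (hW : AntiDegrades W)
    {b f : QubitOp} (hb : b ∈ Matrix.unitaryGroup (Fin 2) ℂ)
    (hf : f ∈ Matrix.unitaryGroup (Fin 2) ℂ) (u : QubitOp) :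
    AntiDegrades ((b ⊗ₖ f) * W * u) := by
  obtain ⟨Φ, hΦ, h⟩ := hW
  obtain ⟨β, hβ, hβ'⟩ := exists_isCPTP_conj hb
  obtain ⟨φ, hφ, hφ'⟩ := exists_isCPTP_conj (Unitary.star_mem hf)
  refine ⟨β ∘ₗ Φ ∘ₗ φ, hβ.comp (hΦ.comp hφ), fun ρ => ?_⟩
  have e : (b ⊗ₖ f) * W * u * ρ * ((b ⊗ₖ f) * W * u)ᴴ =
      (b ⊗ₖ f) * (W * (u * ρ * uᴴ) * Wᴴ) * (b ⊗ₖ f)ᴴ := by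
    simp only [Matrix.conjTranspose_mul, Matrix.mul_assoc]
  have hff : ∀ Y : QubitOp, star f * (f * Y * fᴴ) * (star f)ᴴ = Y := fun Y => by
    rw [Matrix.star_eq_conjTranspose, Matrix.conjTranspose_conjTranspose,
      show fᴴ * (f * Y * fᴴ) * f = (fᴴ * f) * Y * (fᴴ * f) by simp only [Matrix.mul_assoc],
      ← Matrix.star_eq_conjTranspose, Matrix.mem_unitaryGroup_iff'.1 hf, Matrix.one_mul,
      Matrix.mul_one]
  simp only [e, traceB_kronecker_conj hb, traceF_kronecker_conj hf, LinearMap.comp_apply, hφ',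
    hff, hβ']
  rw [← h]

theorem kronecker_mem_unitaryGroup {a b : QubitOp} (ha : a ∈ Matrix.unitaryGroup (Fin 2) ℂ)
    (hb : b ∈ Matrix.unitaryGroup (Fin 2) ℂ) :
    a ⊗ₖ b ∈ Matrix.unitaryGroup (Fin 2 × Fin 2) ℂ :=
  Matrix.kronecker_mem_unitary ha hb

theorem LocallyEquiv.mem_univAntiDegradable {V W : TwoQubitOp} (h : LocallyEquiv V W)
    (hW : W ∈ univAntiDegradable) : V ∈ univAntiDegradable := by
  obtain ⟨a, ha, b, hb, c, hc, d, hd, rfl⟩ := h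
  refine ⟨mul_mem (mul_mem (kronecker_mem_unitaryGroup ha hb) hW.1)
    (kronecker_mem_unitaryGroup hc hd), fun η hη => ?_⟩
  have := (isAntiDegradableAt_iff _ _).1 (hW.2 _ (isUnitKet_mulVec hd hη))
  rw [isAntiDegradableAt_iff, Matrix.mul_assoc _ (c ⊗ₖ d), kronecker_mul_appendKet,
    ← Matrix.mul_assoc, Matrix.mul_assoc _ W]
  exact this.local ha hb c

theorem LocallyEquiv.symm {V W : TwoQubitOp} (h : LocallyEquiv V W) : LocallyEquiv W V := by
  obtain ⟨a, ha, b, hb, c, hc, d, hd, rfl⟩ := h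
  refine ⟨_, Unitary.star_mem ha, _, Unitary.star_mem hb, _, Unitary.star_mem hc, _,
    Unitary.star_mem hd, ?_⟩
  have h1 : (star a ⊗ₖ star b) * (a ⊗ₖ b) = 1 := by
    rw [← Matrix.mul_kronecker_mul, Matrix.mem_unitaryGroup_iff'.1 ha,
      Matrix.mem_unitaryGroup_iff'.1 hb, Matrix.one_kronecker_one]
  have h2 : (c ⊗ₖ d) * (star c ⊗ₖ star d) = 1 := by
    rw [← Matrix.mul_kronecker_mul, Matrix.mem_unitaryGroup_iff.1 hc,
      Matrix.mem_unitaryGroup_iff.1 hd, Matrix.one_kronecker_one]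
  calc W = (star a ⊗ₖ star b) * (a ⊗ₖ b) * W * ((c ⊗ₖ d) * (star c ⊗ₖ star d)) := by
        rw [h1, h2, Matrix.one_mul, Matrix.mul_one]
    _ = _ := by simp only [Matrix.mul_assoc]

theorem LocallyEquiv.trans {U V W : TwoQubitOp} (h : LocallyEquiv U V) (h' : LocallyEquiv V W) :
    LocallyEquiv U W := by
  obtain ⟨a, ha, b, hb, c, hc, d, hd, rfl⟩ := h
  obtain ⟨a', ha', b', hb', c', hc', d', hd', rfl⟩ := h'
  refine ⟨_, mul_mem ha ha', _, mul_mem hb hb', _, mul_mem hc' hc, _, mul_mem hd' hd, ?_⟩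
  simp only [Matrix.mul_kronecker_mul, Matrix.mul_assoc]

theorem LocallyEquiv.swapGate_mul {V W : TwoQubitOp} (h : LocallyEquiv V W) :
    LocallyEquiv (swapGate * V) (swapGate * W) := by
  obtain ⟨a, ha, b, hb, c, hc, d, hd, rfl⟩ := h
  refine ⟨b, hb, a, ha, c, hc, d, hd, ?_⟩
  rw [← Matrix.mul_assoc (b ⊗ₖ a), ← swapGate_mul_kronecker]
  simp only [Matrix.mul_assoc]

theorem LocallyEquiv.mem_univDegradable {V W : TwoQubitOp} (h : LocallyEquiv V W)
    (hW : W ∈ univDegradable) : V ∈ univDegradable := by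
  rw [mem_univDegradable_iff] at *
  exact h.swapGate_mul.mem_univAntiDegradable hW

/-! ### Channels in Schmidt normal form -/

/-- The map `|0⟩ ↦ p|00⟩ + q|11⟩`, `|1⟩ ↦ r|10⟩ + s|01⟩`. -/
def schmidtForm (p q r s : ℂ) : Matrix (Fin 2 × Fin 2) (Fin 2) ℂ :=
  Matrix.of fun x a => (![![![p, 0], ![0, s]], ![![0, r], ![q, 0]]] : _) x.1 x.2 a

theorem traceB_schmidtForm (p q r s : ℂ) (ρ : QubitOp) :
    traceB (schmidtForm p q r s * ρ * (schmidtForm p q r s)ᴴ) =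
      !![p * star p * ρ 0 0 + r * star r * ρ 1 1, p * star s * ρ 0 1 + r * star q * ρ 1 0;
        s * star p * ρ 1 0 + q * star r * ρ 0 1, q * star q * ρ 0 0 + s * star s * ρ 1 1] := by
  ext i j
  fin_cases i <;> fin_cases j <;>
    simp [schmidtForm, traceB, Matrix.mul_apply, Fin.sum_univ_two] <;> ring

theorem traceF_schmidtForm (p q r s : ℂ) (ρ : QubitOp) :
    traceF (schmidtForm p q r s * ρ * (schmidtForm p q r s)ᴴ) =
      !![p * star p * ρ 0 0 + s * star s * ρ 1 1, p * star r * ρ 0 1 + s * star q * ρ 1 0;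
        r * star p * ρ 1 0 + q * star s * ρ 0 1, q * star q * ρ 0 0 + r * star r * ρ 1 1] := by
  ext i j
  fin_cases i <;> fin_cases j <;>
    simp [schmidtForm, traceF, Matrix.mul_apply, Fin.sum_univ_two] <;> ring

/-- The simulating channel of a channel in real Schmidt form has Kraus operators
`diag(s μ, r μ)` and `p κ|0⟩⟨1| + q κ|1⟩⟨0|`; the sign condition is what makes the equations for
`κ²` and `μ²` solvable. -/
theorem antiDegrades_schmidtForm {p q r s : ℝ} (hpq : p ^ 2 + q ^ 2 = 1) (hrs : r ^ 2 + s ^ 2 = 1)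
    (h : (p ^ 2 - q ^ 2) * (r ^ 2 - s ^ 2) ≤ 0) : AntiDegrades (schmidtForm p q r s) := by
  obtain ⟨κ, μ, h1, h2⟩ : ∃ κ μ : ℝ, q ^ 2 * κ ^ 2 + s ^ 2 * μ ^ 2 = 1 ∧
      p ^ 2 * κ ^ 2 + r ^ 2 * μ ^ 2 = 1 := by
    by_cases hpr : p ^ 2 = r ^ 2
    · have hp : p ^ 2 = 1 / 2 := by
        have hq : q ^ 2 = 1 - p ^ 2 := by linarith
        have hs : s ^ 2 = 1 - p ^ 2 := by linarith
        rw [← hpr, hq, hs] at h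
        have : (2 * p ^ 2 - 1) ^ 2 = 0 := le_antisymm (by nlinarith) (sq_nonneg _)
        have := pow_eq_zero_iff (two_ne_zero) |>.1 this
        linarith
      exact ⟨1, 1, by linarith, by linarith⟩
    · have hd : p ^ 2 - r ^ 2 ≠ 0 := sub_ne_zero.2 hpr
      have hk : 0 ≤ (s ^ 2 - r ^ 2) / (p ^ 2 - r ^ 2) ∧
          0 ≤ (p ^ 2 - q ^ 2) / (p ^ 2 - r ^ 2) := by
        rcases lt_or_gt_of_ne hpr with hlt | hlt
        · constructor <;> refine div_nonneg_of_nonpos ?_ (by linarith) <;> nlinarith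
        · constructor <;> refine div_nonneg ?_ (by linarith) <;> nlinarith
      refine ⟨√((s ^ 2 - r ^ 2) / (p ^ 2 - r ^ 2)), √((p ^ 2 - q ^ 2) / (p ^ 2 - r ^ 2)), ?_, ?_⟩
      all_goals
        rw [Real.sq_sqrt hk.1, Real.sq_sqrt hk.2]
        field_simp
        have hq : q ^ 2 = 1 - p ^ 2 := by linarith
        have hs : s ^ 2 = 1 - r ^ 2 := by linarith
        rw [hq, hs]
        ring
  have c1 : (q : ℂ) ^ 2 * κ ^ 2 + s ^ 2 * μ ^ 2 = 1 := by exact_mod_cast h1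
  have c2 : (p : ℂ) ^ 2 * κ ^ 2 + r ^ 2 * μ ^ 2 = 1 := by exact_mod_cast h2
  let K : Fin 2 → QubitOp :=
    ![!![(s * μ : ℂ), 0; 0, r * μ], !![0, (p * κ : ℂ); q * κ, 0]]
  refine ⟨krausMap K, isCPTP_krausMap ?_, fun ρ => ?_⟩
  · ext i j
    fin_cases i <;> fin_cases j <;>
      simp [K, Fin.sum_univ_two, Matrix.mul_apply]
    · linear_combination c1
    · linear_combination c2
  · simp only [traceB_schmidtForm, traceF_schmidtForm, krausMap_apply, Fin.sum_univ_two]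
    ext i j
    fin_cases i <;> fin_cases j <;>
      simp [K, Matrix.vecMul, dotProduct]
    · linear_combination -(p ^ 2 * ρ 0 0 : ℂ) * c1 - (s ^ 2 * ρ 1 1 : ℂ) * c2
    · linear_combination -(p * r * ρ 0 1 : ℂ) * c1 - (q * s * ρ 1 0 : ℂ) * c2
    · linear_combination -(p * r * ρ 1 0 : ℂ) * c1 - (q * s * ρ 0 1 : ℂ) * c2
    · linear_combination -(q ^ 2 * ρ 0 0 : ℂ) * c2 - (r ^ 2 * ρ 1 1 : ℂ) * c1

theorem IsCPTP.posSemidef {Φ : QubitOp →ₗ[ℂ] QubitOp} (hΦ : IsCPTP Φ) {X : QubitOp}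
    (hX : X.PosSemidef) : (Φ X).PosSemidef :=
  (hΦ.completelyPositive 1 _ (hX.submatrix (Prod.snd : Fin 1 × Fin 2 → Fin 2))).submatrix
    fun a => ((0 : Fin 1), a)

/-- A CPTP map sends `|i⟩⟨i|` to a density matrix, so its diagonal entries lie in `[0, 1]`. -/
theorem IsCPTP.exists_apply_single {Φ : QubitOp →ₗ[ℂ] QubitOp} (hΦ : IsCPTP Φ) (i : Fin 2) :
    ∃ x : ℝ, Φ (Matrix.single i i 1) 0 0 = x ∧ 0 ≤ x ∧ x ≤ 1 := by
  have hpos : (Matrix.single i i (1 : ℂ)).PosSemidef := by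
    have : Matrix.single i i (1 : ℂ) = Matrix.diagonal (Pi.single i 1) := by
      rw [Matrix.diagonal_single]
    rw [this]
    exact Matrix.PosSemidef.diagonal (by
      intro j
      by_cases h : j = i
      · subst h; simp
      · simp [h])
  have h := hΦ.posSemidef hpos
  have h0 := h.diag_nonneg (i := 0)
  have h1 := h.diag_nonneg (i := 1)
  have ht := hΦ.tracePreserving (Matrix.single i i 1)
  rw [Matrix.trace_fin_two, Matrix.trace_single_eq_same] at ht
  rw [Complex.nonneg_iff] at h0 h1
  have htr := congrArg Complex.re ht
  simp only [Complex.add_re, Complex.one_re] at htr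
  exact ⟨_, Complex.ext rfl h0.2.symm, h0.1, by linarith [h1.1]⟩

/-- In Schmidt form both channels send `|0⟩⟨0|` and `|1⟩⟨1|` to diagonal matrices. On these the
simulating map, read on the diagonal, is a stochastic map, so it cannot increase the distance
between the two images. -/
theorem AntiDegrades.sq_le_of_schmidtForm {p q r s : ℂ}
    (hpq : Complex.normSq p + Complex.normSq q = 1) (hrs : Complex.normSq r + Complex.normSq s = 1)
    (h : AntiDegrades (schmidtForm p q r s)) :
    (Complex.normSq p - Complex.normSq s) ^ 2 ≤ (Complex.normSq p - Complex.normSq r) ^ 2 := by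
  obtain ⟨Φ, hΦ, h⟩ := h
  obtain ⟨x, hx, hx0, hx1⟩ := hΦ.exists_apply_single 0
  obtain ⟨y, hy, hy0, hy1⟩ := hΦ.exists_apply_single 1
  have hdiag : ∀ a b : ℂ, Φ !![a, 0; 0, b] 0 0 = a * x + b * y := fun a b => by
    have : !![a, 0; 0, b] = a • Matrix.single 0 0 (1 : ℂ) + b • Matrix.single 1 1 1 := by
      ext i j
      fin_cases i <;> fin_cases j <;> simp
    rw [this, map_add, map_smul, map_smul, Matrix.add_apply, Matrix.smul_apply, Matrix.smul_apply,
      hx, hy, smul_eq_mul, smul_eq_mul]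
  have e0 := congrFun₂ (h (Matrix.single 0 0 1)) 0 0
  have e1 := congrFun₂ (h (Matrix.single 1 1 1)) 0 0
  simp only [traceB_schmidtForm, traceF_schmidtForm] at e0 e1
  simp [hdiag, Complex.mul_conj] at e0 e1
  norm_cast at e0 e1
  have e : (Complex.normSq p - Complex.normSq r) * (x - y) =
      Complex.normSq p - Complex.normSq s := by
    linear_combination -e0 + e1 - y * hpq + y * hrs
  rw [← e, mul_pow]
  exact mul_le_of_le_one_right (sq_nonneg _) (by nlinarith)

/-! ### The orientation of a Stinespring isometry -/

/-- The antilinear map `w ↦ (σ_y ⊗ σ_y) w̄`, up to sign; it commutes with `SU(2) ⊗ SU(2)`. -/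
def spinFlip (W : Matrix (Fin 2 × Fin 2) (Fin 2) ℂ) : Matrix (Fin 2 × Fin 2) (Fin 2) ℂ :=
  ((!![0, 1; -1, 0] : QubitOp) ⊗ₖ (!![0, 1; -1, 0] : QubitOp)) * W.map star

/-- The matrix with columns `w₀, w̃₀, w₁, w̃₁`, where `w₀, w₁` are the columns of `W` and the tilde
is the spin flip. -/
def flipFrame (W : Matrix (Fin 2 × Fin 2) (Fin 2) ℂ) : TwoQubitOp :=
  Matrix.of fun x c => ![W x c.1, spinFlip W x c.1] c.2

/-- The determinant of the frame `w₀, w̃₀, w₁, w̃₁`. It is invariant under unitaries of `A` and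
under `SU(2) ⊗ SU(2)` acting on `B ⊗ F`, and its sign decides degradability. -/
def orientation (W : Matrix (Fin 2 × Fin 2) (Fin 2) ℂ) : ℂ :=
  (flipFrame W).det

theorem det_twoQubitOp (M : TwoQubitOp) :
    M.det = (!![M (0, 0) (0, 0), M (0, 0) (0, 1), M (0, 0) (1, 0), M (0, 0) (1, 1);
      M (0, 1) (0, 0), M (0, 1) (0, 1), M (0, 1) (1, 0), M (0, 1) (1, 1);
      M (1, 0) (0, 0), M (1, 0) (0, 1), M (1, 0) (1, 0), M (1, 0) (1, 1);
      M (1, 1) (0, 0), M (1, 1) (0, 1), M (1, 1) (1, 0), M (1, 1) (1, 1)] :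
        Matrix (Fin 4) (Fin 4) ℂ).det := by
  rw [← Matrix.det_submatrix_equiv_self (finProdFinEquiv (m := 2) (n := 2)).symm M]
  congr 1
  ext i j
  fin_cases i <;> fin_cases j <;> rfl

/-- Laplace expansion of a `4 × 4` determinant along the first row. -/
theorem det_fin_four (M : Matrix (Fin 4) (Fin 4) ℂ) :
    M.det = M 0 0 * (M 1 1 * (M 2 2 * M 3 3 - M 2 3 * M 3 2)
        - M 1 2 * (M 2 1 * M 3 3 - M 2 3 * M 3 1) + M 1 3 * (M 2 1 * M 3 2 - M 2 2 * M 3 1))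
      - M 0 1 * (M 1 0 * (M 2 2 * M 3 3 - M 2 3 * M 3 2)
        - M 1 2 * (M 2 0 * M 3 3 - M 2 3 * M 3 0) + M 1 3 * (M 2 0 * M 3 2 - M 2 2 * M 3 0))
      + M 0 2 * (M 1 0 * (M 2 1 * M 3 3 - M 2 3 * M 3 1)
        - M 1 1 * (M 2 0 * M 3 3 - M 2 3 * M 3 0) + M 1 3 * (M 2 0 * M 3 1 - M 2 1 * M 3 0))
      - M 0 3 * (M 1 0 * (M 2 1 * M 3 2 - M 2 2 * M 3 1)
        - M 1 1 * (M 2 0 * M 3 2 - M 2 2 * M 3 0) + M 1 2 * (M 2 0 * M 3 1 - M 2 1 * M 3 0)) := by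
  rw [Matrix.det_succ_row_zero]
  simp [Fin.sum_univ_four, Matrix.det_fin_three, Fin.succAbove, Matrix.submatrix_apply]
  ring

theorem spinFlip_apply (W : Matrix (Fin 2 × Fin 2) (Fin 2) ℂ) (a : Fin 2) :
    spinFlip W (0, 0) a = star (W (1, 1) a) ∧ spinFlip W (0, 1) a = -star (W (1, 0) a) ∧
      spinFlip W (1, 0) a = -star (W (0, 1) a) ∧ spinFlip W (1, 1) a = star (W (0, 0) a) := by
  simp [spinFlip, Matrix.mul_apply, Fintype.sum_prod_type]

theorem orientation_schmidtForm (p q r s : ℝ) :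
    orientation (schmidtForm p q r s) = (((p ^ 2 - q ^ 2) * (r ^ 2 - s ^ 2) : ℝ) : ℂ) := by
  rw [orientation, det_twoQubitOp, det_fin_four]
  simp [flipFrame, spinFlip_apply, schmidtForm]
  ring

theorem spinFlip_kronecker_mul {a b : QubitOp} (ha : a ∈ Matrix.specialUnitaryGroup (Fin 2) ℂ)
    (hb : b ∈ Matrix.specialUnitaryGroup (Fin 2) ℂ) (W : Matrix (Fin 2 × Fin 2) (Fin 2) ℂ) :
    spinFlip ((a ⊗ₖ b) * W) = (a ⊗ₖ b) * spinFlip W := by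
  have key : ∀ {u : QubitOp}, u ∈ Matrix.specialUnitaryGroup (Fin 2) ℂ →
      (!![0, 1; -1, 0] : QubitOp) * u.map star = u * !![0, 1; -1, 0] := fun {u} hu => by
    rw [Matrix.mem_specialUnitaryGroup_iff] at hu
    have h1 := Matrix.mem_unitaryGroup_iff.1 hu.1
    have h2 : u * (!![0, 1; -1, 0] : QubitOp) * uᵀ = !![0, 1; -1, 0] := by
      have := hu.2
      rw [Matrix.det_fin_two] at this
      ext i j
      fin_cases i <;> fin_cases j <;> simp [Matrix.mul_apply, Fin.sum_univ_two]
      · ring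
      · linear_combination this
      · linear_combination -this
      · ring
    have h3 : uᵀ * u.map star = 1 := by
      have := congrArg Matrix.transpose (Matrix.mem_unitaryGroup_iff'.1 hu.1)
      rw [Matrix.transpose_mul, Matrix.transpose_one] at this
      exact this
    rw [← h2, Matrix.mul_assoc _ _ (u.map star), h3, Matrix.mul_one, h2]
  have hmap : ((a ⊗ₖ b) * W).map star = ((a.map star) ⊗ₖ (b.map star)) * W.map star := by
    ext x c
    simp [Matrix.mul_apply]
  rw [spinFlip, spinFlip, hmap, ← Matrix.mul_assoc, ← Matrix.mul_kronecker_mul, key ha, key hb,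
    Matrix.mul_kronecker_mul, Matrix.mul_assoc]

theorem orientation_kronecker_mul {a b : QubitOp}
    (ha : a ∈ Matrix.specialUnitaryGroup (Fin 2) ℂ)
    (hb : b ∈ Matrix.specialUnitaryGroup (Fin 2) ℂ) (W : Matrix (Fin 2 × Fin 2) (Fin 2) ℂ) :
    orientation ((a ⊗ₖ b) * W) = orientation W := by
  have h : flipFrame ((a ⊗ₖ b) * W) = (a ⊗ₖ b) * flipFrame W := by
    ext x ⟨c, t⟩
    fin_cases t
    · simp [flipFrame, Matrix.mul_apply]
    · simp only [flipFrame, spinFlip_kronecker_mul ha hb]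
      simp [Matrix.mul_apply]
  rw [orientation, h, Matrix.det_mul, Matrix.det_kronecker,
    (Matrix.mem_specialUnitaryGroup_iff.1 ha).2, (Matrix.mem_specialUnitaryGroup_iff.1 hb).2]
  simp [orientation]

theorem spinFlip_mul (W : Matrix (Fin 2 × Fin 2) (Fin 2) ℂ) (u : QubitOp) :
    spinFlip (W * u) = spinFlip W * u.map star := by
  have : (W * u).map star = W.map star * u.map star := by
    ext x c
    simp [Matrix.mul_apply]
  rw [spinFlip, spinFlip, this, Matrix.mul_assoc]

theorem orientation_mul {u : QubitOp} (hu : u ∈ Matrix.unitaryGroup (Fin 2) ℂ)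
    (W : Matrix (Fin 2 × Fin 2) (Fin 2) ℂ) : orientation (W * u) = orientation W := by
  have h : flipFrame (W * u) = flipFrame W * Matrix.blockDiagonal ![u, u.map star] := by
    ext x ⟨c, t⟩
    simp only [flipFrame, spinFlip_mul, Matrix.mul_apply, Matrix.of_apply, Fintype.sum_prod_type,
      Matrix.blockDiagonal_apply]
    fin_cases t <;> simp
  have hd : (u.map star).det = star u.det := by
    simp [Matrix.det_fin_two]
  have h1 := congrArg Matrix.det (Matrix.mem_unitaryGroup_iff'.1 hu)
  rw [Matrix.det_mul, Matrix.star_eq_conjTranspose, Matrix.det_conjTranspose, Matrix.det_one] at h1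
  rw [orientation, h, Matrix.det_mul, Matrix.det_blockDiagonal, Fin.prod_univ_two]
  simp only [Matrix.cons_val_zero, Matrix.cons_val_one, hd]
  rw [mul_comm u.det, h1, mul_one, orientation]

/-! ### The magic basis and `SO(4) = SU(2) ⊗ SU(2)` -/

theorem inv_sqrt_two_mul_self :
    (((Real.sqrt 2 : ℝ) : ℂ)⁻¹) * (((Real.sqrt 2 : ℝ) : ℂ)⁻¹) = 1 / 2 := by
  rw [← mul_inv, ← Complex.ofReal_mul, Real.mul_self_sqrt (by norm_num)]
  norm_num

/-- The two-qubit vector with real coordinates `x` in the magic basis. -/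
def magicVec (x : EuclideanSpace ℝ (Fin 4)) : Fin 2 × Fin 2 → ℂ :=
  ∑ k, (x k : ℂ) • magicBasis k

theorem magicVec_apply (x : EuclideanSpace ℝ (Fin 4)) :
    magicVec x (0, 0) = ((Real.sqrt 2 : ℝ) : ℂ)⁻¹ * (x 0 - x 1 * Complex.I) ∧
    magicVec x (0, 1) = ((Real.sqrt 2 : ℝ) : ℂ)⁻¹ * (x 2 - x 3 * Complex.I) ∧
    magicVec x (1, 0) = ((Real.sqrt 2 : ℝ) : ℂ)⁻¹ * (-x 2 - x 3 * Complex.I) ∧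
    magicVec x (1, 1) = ((Real.sqrt 2 : ℝ) : ℂ)⁻¹ * (x 0 + x 1 * Complex.I) := by
  simp only [magicVec, Fin.sum_univ_four]
  refine ⟨?_, ?_, ?_, ?_⟩ <;> simp [magicBasis, ket] <;> ring

theorem magicVec_single (k : Fin 4) :
    magicVec (EuclideanSpace.single k 1) = magicBasis k := by
  rw [magicVec, Finset.sum_eq_single k]
  · simp
  · intro j _ hj
    simp [hj]
  · simp

theorem magicVec_smul (c : ℝ) (x : EuclideanSpace ℝ (Fin 4)) :
    magicVec (c • x) = (c : ℂ) • magicVec x := by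
  simp only [magicVec, Finset.smul_sum, smul_smul, PiLp.smul_apply, smul_eq_mul,
    Complex.ofReal_mul]

theorem star_magicVec_dotProduct (x y : EuclideanSpace ℝ (Fin 4)) :
    star (magicVec x) ⬝ᵥ magicVec y = ((inner ℝ x y : ℝ) : ℂ) := by
  obtain ⟨x0, x1, x2, x3⟩ := magicVec_apply x
  obtain ⟨y0, y1, y2, y3⟩ := magicVec_apply y
  simp only [dotProduct, Fintype.sum_prod_type, Fin.sum_univ_two, Pi.star_apply, x0, x1, x2, x3,
    y0, y1, y2, y3, PiLp.inner_apply, Fin.sum_univ_four]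
  simp
  have h := inv_sqrt_two_mul_self
  linear_combination (2 * (x 0 * y 0 + x 1 * y 1 + x 2 * y 2 + x 3 * y 3) : ℂ) * h
    - 2 * ((Real.sqrt 2 : ℝ) : ℂ)⁻¹ * ((Real.sqrt 2 : ℝ) : ℂ)⁻¹ *
      (x 1 * y 1 + x 3 * y 3 : ℂ) * Complex.I_sq

theorem exists_eq_magicVec_add (w : Fin 2 × Fin 2 → ℂ) :
    ∃ x y : EuclideanSpace ℝ (Fin 4), w = magicVec x + Complex.I • magicVec y := by
  let r : ℂ := ((Real.sqrt 2 : ℝ) : ℂ)⁻¹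
  let c : Fin 4 → ℂ := ![r * (w (0, 0) + w (1, 1)), r * (Complex.I * (w (0, 0) - w (1, 1))),
    r * (w (0, 1) - w (1, 0)), r * (Complex.I * (w (0, 1) + w (1, 0)))]
  have hc : ∀ k, ((c k).re : ℂ) + Complex.I * (c k).im = c k := fun k => by
    rw [mul_comm]; exact Complex.re_add_im _
  have h := inv_sqrt_two_mul_self
  refine ⟨WithLp.toLp 2 fun k => (c k).re, WithLp.toLp 2 fun k => (c k).im, ?_⟩
  obtain ⟨x0, x1, x2, x3⟩ := magicVec_apply (WithLp.toLp 2 fun k => (c k).re)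
  obtain ⟨y0, y1, y2, y3⟩ := magicVec_apply (WithLp.toLp 2 fun k => (c k).im)
  ext ⟨i, j⟩
  have h0 := hc 0
  have h1 := hc 1
  have h2 := hc 2
  have h3 := hc 3
  simp only [c, Matrix.cons_val] at h0 h1 h2 h3
  fin_cases i <;> fin_cases j <;>
    simp only [Fin.zero_eta, Fin.mk_one, Pi.add_apply, Pi.smul_apply, smul_eq_mul, x0, x1, x2, x3,
      y0, y1, y2, y3, c, Matrix.cons_val]
  · linear_combination -r * h0 + r * Complex.I * h1 - 2 * w (0, 0) * h
      + r * r * (w (0, 0) - w (1, 1)) * Complex.I_sq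
  · linear_combination -r * h2 + r * Complex.I * h3 - 2 * w (0, 1) * h
      + r * r * (w (0, 1) + w (1, 0)) * Complex.I_sq
  · linear_combination r * h2 + r * Complex.I * h3 - 2 * w (1, 0) * h
      + r * r * (w (0, 1) + w (1, 0)) * Complex.I_sq
  · linear_combination -r * h0 - r * Complex.I * h1 - 2 * w (1, 1) * h
      - r * r * (w (0, 0) - w (1, 1)) * Complex.I_sq

/-- Products `a ⊗ b` with `a, b ∈ SU(2)`, possibly times the swap. In the magic basis these are
the real orthogonal matrices. -/
def IsLocalOrSwap (g : TwoQubitOp) : Prop :=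
  ∃ a ∈ Matrix.specialUnitaryGroup (Fin 2) ℂ, ∃ b ∈ Matrix.specialUnitaryGroup (Fin 2) ℂ,
    g = a ⊗ₖ b ∨ g = (a ⊗ₖ b) * swapGate

theorem IsLocalOrSwap.mul {g h : TwoQubitOp} (hg : IsLocalOrSwap g) (hh : IsLocalOrSwap h) :
    IsLocalOrSwap (g * h) := by
  obtain ⟨a, ha, b, hb, hg⟩ := hg
  obtain ⟨c, hc, d, hd, hh⟩ := hh
  rcases hg with rfl | rfl
  · refine ⟨_, mul_mem ha hc, _, mul_mem hb hd, ?_⟩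
    rcases hh with rfl | rfl
    · left; rw [Matrix.mul_kronecker_mul]
    · right; rw [Matrix.mul_kronecker_mul, Matrix.mul_assoc]
  · refine ⟨_, mul_mem ha hd, _, mul_mem hb hc, ?_⟩
    rcases hh with rfl | rfl
    · right
      rw [Matrix.mul_kronecker_mul, Matrix.mul_assoc, swapGate_mul_kronecker, Matrix.mul_assoc]
    · left
      rw [Matrix.mul_kronecker_mul, Matrix.mul_assoc, ← Matrix.mul_assoc swapGate,
        swapGate_mul_kronecker, Matrix.mul_assoc _ swapGate, swapGate_mul_self, Matrix.mul_one]

theorem isLocalOrSwap_one : IsLocalOrSwap 1 :=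
  ⟨1, one_mem _, 1, one_mem _, Or.inl Matrix.one_kronecker_one.symm⟩

/-- Reshaping vectors of the magic basis to quaternions, the reflection in the hyperplane
orthogonal to a unit quaternion `u` is `X ↦ -u X* u`, where `X*` is the adjugate of `X`. -/
theorem exists_isLocalOrSwap_of_unit (v : EuclideanSpace ℝ (Fin 4)) (hv : inner ℝ v v = (1 : ℝ)) :
    ∃ g, IsLocalOrSwap g ∧
      ∀ x, magicVec (x - (2 * inner ℝ v x) • v) = g *ᵥ magicVec x := by
  have hI := Complex.I_sq
  have hv' : (v 0 - v 1 * Complex.I) * (v 0 + v 1 * Complex.I) +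
      (v 2 - v 3 * Complex.I) * (v 2 + v 3 * Complex.I) = 1 := by
    simp only [PiLp.inner_apply, Fin.sum_univ_four] at hv
    simp at hv
    have : (v 0 ^ 2 + v 1 ^ 2 + v 2 ^ 2 + v 3 ^ 2 : ℂ) = 1 := by exact_mod_cast hv
    linear_combination this - (v 1 * v 1 + v 3 * v 3 : ℂ) * hI
  have hsu : ∀ x y : ℂ, x * (starRingEnd ℂ) x + y * (starRingEnd ℂ) y = 1 →
      !![x, y; -(starRingEnd ℂ) y, (starRingEnd ℂ) x] ∈ Matrix.specialUnitaryGroup (Fin 2) ℂ := by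
    intro x y h
    rw [Matrix.mem_specialUnitaryGroup_iff, Matrix.mem_unitaryGroup_iff]
    constructor
    · ext i j
      fin_cases i <;> fin_cases j <;> simp [Matrix.mul_apply, Fin.sum_univ_two]
      · exact h
      · ring
      · ring
      · linear_combination h
    · rw [Matrix.det_fin_two_of]
      linear_combination h
  refine ⟨_, ⟨_, hsu (v 2 - v 3 * Complex.I) (-(v 0 - v 1 * Complex.I)) ?_,
    _, hsu (v 2 + v 3 * Complex.I) (v 0 - v 1 * Complex.I) ?_, Or.inr rfl⟩, fun x => ?_⟩
  · simp
    linear_combination hv'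
  · simp
    linear_combination hv'
  · obtain ⟨x0, x1, x2, x3⟩ := magicVec_apply x
    obtain ⟨y0, y1, y2, y3⟩ := magicVec_apply (x - (2 * inner ℝ v x) • v)
    have h2 : 2 * ((inner ℝ v x : ℝ) : ℂ) =
        (x 0 - x 1 * Complex.I) * (v 0 + v 1 * Complex.I) +
        (x 0 + x 1 * Complex.I) * (v 0 - v 1 * Complex.I) +
        (x 2 - x 3 * Complex.I) * (v 2 + v 3 * Complex.I) +
        (x 2 + x 3 * Complex.I) * (v 2 - v 3 * Complex.I) := by
      simp only [PiLp.inner_apply, Fin.sum_univ_four]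
      simp
      linear_combination (2 * x 1 * v 1 + 2 * x 3 * v 3 : ℂ) * hI
    rw [← Matrix.mulVec_mulVec]
    obtain ⟨w, hw⟩ : ∃ w, w = swapGate *ᵥ magicVec x := ⟨_, rfl⟩
    have hs : ∀ i j, w (i, j) = magicVec x (j, i) := fun i j => by
      rw [hw]
      fin_cases i <;> fin_cases j <;>
        simp [swapGate, Matrix.mulVec, dotProduct, Fintype.sum_prod_type]
    rw [← hw]
    ext ⟨i, j⟩
    fin_cases i <;> fin_cases j <;>
    simp only [Fin.zero_eta, Fin.mk_one, Matrix.mulVec, dotProduct, Fintype.sum_prod_type,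
      Fin.sum_univ_two, Matrix.kroneckerMap_apply, hs, x0, x1, x2, x3, y0, y1, y2, y3,
      PiLp.sub_apply, PiLp.smul_apply, smul_eq_mul, Complex.ofReal_sub, Complex.ofReal_mul,
      Complex.ofReal_ofNat, h2] <;>
    simp
    · linear_combination (-((Real.sqrt 2 : ℝ) : ℂ)⁻¹ * (x 0 - x 1 * Complex.I)) * hv'
    · linear_combination (-((Real.sqrt 2 : ℝ) : ℂ)⁻¹ * (x 2 - x 3 * Complex.I)) * hv'
    · linear_combination (-((Real.sqrt 2 : ℝ) : ℂ)⁻¹ * (-x 2 - x 3 * Complex.I)) * hv'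
    · linear_combination (-((Real.sqrt 2 : ℝ) : ℂ)⁻¹ * (x 0 + x 1 * Complex.I)) * hv'

theorem exists_isLocalOrSwap_reflection (v : EuclideanSpace ℝ (Fin 4)) :
    ∃ g, IsLocalOrSwap g ∧
      ∀ x, magicVec ((Submodule.span ℝ {v})ᗮ.reflection x) = g *ᵥ magicVec x := by
  by_cases hv : v = 0
  · refine ⟨1, isLocalOrSwap_one, fun x => ?_⟩
    subst hv
    rw [Submodule.reflection_mem_subspace_eq_self (by simp), Matrix.one_mulVec]
  · have hn : ‖v‖ ≠ 0 := norm_ne_zero_iff.2 hv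
    obtain ⟨g, hg, h⟩ := exists_isLocalOrSwap_of_unit (‖v‖⁻¹ • v) (by
      rw [real_inner_smul_left, real_inner_smul_right, real_inner_self_eq_norm_sq]
      field_simp)
    refine ⟨g, hg, fun x => ?_⟩
    rw [← h, Submodule.reflection_orthogonal_apply, Submodule.reflection_singleton_apply,
      real_inner_smul_left, neg_sub, ← Nat.cast_smul_eq_nsmul ℝ, smul_smul, smul_smul]
    congr 3
    simp only [RCLike.ofReal_real_eq_id, id]
    push_cast
    field_simp

/-- Every real orthonormal basis in magic coordinates is the image of the magic basis under a local
unitary, up to the swap. -/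
theorem exists_isLocalOrSwap_magicVec_eq
    (b : OrthonormalBasis (Fin 4) ℝ (EuclideanSpace ℝ (Fin 4))) :
    ∃ g, IsLocalOrSwap g ∧ ∀ k, magicVec (b k) = g *ᵥ magicBasis k := by
  have key : ∀ l : List (EuclideanSpace ℝ (Fin 4)), ∃ g, IsLocalOrSwap g ∧ ∀ x,
      magicVec ((l.map fun v => (Submodule.span ℝ {v})ᗮ.reflection).prod x) =
        g *ᵥ magicVec x := by
    intro l
    induction l with
    | nil => exact ⟨1, isLocalOrSwap_one, fun x => by simp⟩
    | cons v l ih =>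
      obtain ⟨g, hg, h⟩ := ih
      obtain ⟨g', hg', h'⟩ := exists_isLocalOrSwap_reflection v
      refine ⟨_, hg'.mul hg, fun x => ?_⟩
      rw [List.map_cons, List.prod_cons, LinearIsometryEquiv.coe_mul, Function.comp_apply, h', h,
        Matrix.mulVec_mulVec]
  obtain ⟨l, -, hl⟩ := b.repr.symm.reflections_generate_dim
  obtain ⟨g, hg, h⟩ := key l
  refine ⟨g, hg, fun k => ?_⟩
  rw [← b.repr_symm_single k, hl, h, magicVec_single]

/-! ### Normal forms of isometries -/

/-- Takagi factorization of a symmetric complex `2 × 2` matrix `Q`: the antilinear map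
`v ↦ conj (Q v)` is a symmetric operator on the underlying real space, so it has a real
eigenvalue. -/
theorem exists_unitary_transpose_mul_mul_eq_diagonal {Q : QubitOp} (hQ : Q 0 1 = Q 1 0) :
    ∃ u ∈ Matrix.unitaryGroup (Fin 2) ℂ, ∃ s t : ℝ,
      uᵀ * Q * u = Matrix.diagonal ![(s : ℂ), (t : ℂ)] := by
  let A : Matrix (Fin 2) (Fin 2) ℝ := Q.map Complex.re
  let B : Matrix (Fin 2) (Fin 2) ℝ := Q.map Complex.im
  have hA : Aᵀ = A := by
    ext i j
    fin_cases i <;> fin_cases j <;> simp [A, hQ]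
  have hB : Bᵀ = B := by
    ext i j
    fin_cases i <;> fin_cases j <;> simp [B, hQ]
  have hM : (Matrix.fromBlocks A (-B) (-B) (-A)).IsHermitian := by
    rw [Matrix.IsHermitian, Matrix.conjTranspose_eq_transpose_of_trivial,
      Matrix.fromBlocks_transpose, Matrix.transpose_neg, Matrix.transpose_neg, hA, hB]
  have hev := hM.mulVec_eigenvectorBasis (Sum.inl 0)
  have hnorm := hM.eigenvectorBasis.orthonormal.1 (Sum.inl 0)
  rw [← sq_eq_sq₀ (norm_nonneg _) zero_le_one, EuclideanSpace.norm_sq_eq] at hnorm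
  set v := hM.eigenvectorBasis (Sum.inl 0)
  set s := hM.eigenvalues (Sum.inl 0)
  have e0 := congrFun hev (Sum.inl 0)
  have e1 := congrFun hev (Sum.inl 1)
  have e2 := congrFun hev (Sum.inr 0)
  have e3 := congrFun hev (Sum.inr 1)
  simp [Matrix.mulVec, dotProduct, A, B] at e0 e1 e2 e3 hnorm
  let α : ℂ := ⟨v (Sum.inl 0), v (Sum.inr 0)⟩
  let β : ℂ := ⟨v (Sum.inl 1), v (Sum.inr 1)⟩
  have f0 : Q 0 0 * α + Q 0 1 * β = s * star α := by
    apply Complex.ext <;> simp [α, β] <;> linarith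
  have f1 : Q 1 0 * α + Q 1 1 * β = s * star β := by
    apply Complex.ext <;> simp [α, β] <;> linarith
  have hαβ : α * star α + β * star β = 1 := by
    apply Complex.ext <;> simp [α, β] <;> linarith
  obtain ⟨e, he, t, ht⟩ : ∃ e : ℂ, e * star e = 1 ∧ ∃ t : ℝ,
      e ^ 2 * (Q 0 0 * star β ^ 2 - 2 * Q 0 1 * star α * star β + Q 1 1 * star α ^ 2) = t := by
    generalize (Q 0 0 * star β ^ 2 - 2 * Q 0 1 * star α * star β + Q 1 1 * star α ^ 2) = z
    obtain ⟨r, θ, rfl⟩ : ∃ r θ : ℝ, z = r * Complex.exp (θ * Complex.I) :=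
      ⟨_, _, (Complex.norm_mul_exp_arg_mul_I z).symm⟩
    refine ⟨Complex.exp ((-(θ / 2) : ℝ) * Complex.I), ?_, r, ?_⟩
    · rw [Complex.star_def, Complex.mul_conj, Complex.normSq_eq_norm_sq,
        Complex.norm_exp_ofReal_mul_I]
      norm_num
    · rw [← Complex.exp_nat_mul, mul_left_comm, ← Complex.exp_add]
      rw [show ((2 : ℕ) : ℂ) * ((-(θ / 2) : ℝ) * Complex.I) + θ * Complex.I = 0 by
        push_cast; ring]
      simp
  simp only [Complex.star_def] at *
  refine ⟨!![α, -e * star β; β, e * star α], ?_, s, t, ?_⟩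
  · rw [Matrix.mem_unitaryGroup_iff']
    ext i j
    fin_cases i <;> fin_cases j <;> simp [Matrix.mul_apply]
    · linear_combination hαβ
    · ring
    · ring
    · linear_combination hαβ * e * (starRingEnd ℂ) e + he
  · ext i j
    fin_cases i <;> fin_cases j <;> simp [Matrix.mul_apply]
    · linear_combination α * f0 + β * f1 + s * hαβ
    · linear_combination e * (starRingEnd ℂ) α * f1 - e * (starRingEnd ℂ) β * f0 +
        e * (α * (starRingEnd ℂ) α + β * (starRingEnd ℂ) β) * hQ
    · linear_combination e * (starRingEnd ℂ) α * f1 - e * (starRingEnd ℂ) β * f0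
    · linear_combination ht + e ^ 2 * (starRingEnd ℂ) α * (starRingEnd ℂ) β * hQ

theorem exists_orthonormalBasis_of_pairwise_inner_eq_zero {ι : Type} [Fintype ι]
    (f : ι → EuclideanSpace ℝ ι) (hf : Pairwise fun i j => inner ℝ (f i) (f j) = (0 : ℝ)) :
    ∃ (b : OrthonormalBasis ι ℝ (EuclideanSpace ℝ ι)) (c : ι → ℝ), ∀ i, f i = c i • b i := by
  have ho : Orthonormal ℝ ({i | f i ≠ 0}.domRestrict fun i => ‖f i‖⁻¹ • f i) := by
    constructor
    · rintro ⟨i, hi⟩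
      have : ‖f i‖ ≠ 0 := norm_ne_zero_iff.2 hi
      simp [norm_smul, this]
    · rintro ⟨i, hi⟩ ⟨j, hj⟩ hij
      have : i ≠ j := fun h => hij (Subtype.ext h)
      simp [real_inner_smul_left, real_inner_smul_right, hf this]
  obtain ⟨b, hb⟩ := ho.exists_orthonormalBasis_extension_of_card_eq (by simp)
  refine ⟨b, fun i => ‖f i‖, fun i => ?_⟩
  by_cases hi : f i = 0
  · simp [hi]
  · rw [hb i hi, smul_smul, mul_inv_cancel₀ (norm_ne_zero_iff.2 hi), one_smul]

theorem dotProduct_magicVec_add (x y x' y' : EuclideanSpace ℝ (Fin 4)) :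
    star (magicVec x + Complex.I • magicVec y) ⬝ᵥ (magicVec x' + Complex.I • magicVec y') =
      ((inner ℝ x x' + inner ℝ y y' : ℝ) : ℂ) +
        ((inner ℝ x y' - inner ℝ y x' : ℝ) : ℂ) * Complex.I := by
  simp only [star_add, star_smul, add_dotProduct, dotProduct_add, smul_dotProduct, dotProduct_smul,
    star_magicVec_dotProduct, smul_eq_mul, Complex.star_def, Complex.conj_I]
  push_cast
  linear_combination -(inner ℝ y y' : ℂ) * Complex.I_sq

/-- The spin flip is complex conjugation in magic coordinates. -/
theorem spinFlip_eq_of_magicVec {W : Matrix (Fin 2 × Fin 2) (Fin 2) ℂ}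
    {x y : EuclideanSpace ℝ (Fin 4)} {a : Fin 2}
    (h : ∀ p, W p a = (magicVec x + Complex.I • magicVec y) p) (p : Fin 2 × Fin 2) :
    spinFlip W p a = (magicVec x + Complex.I • magicVec (-y)) p := by
  obtain ⟨f0, f1, f2, f3⟩ := spinFlip_apply W a
  obtain ⟨x0, x1, x2, x3⟩ := magicVec_apply x
  obtain ⟨y0, y1, y2, y3⟩ := magicVec_apply y
  obtain ⟨z0, z1, z2, z3⟩ := magicVec_apply (-y)
  obtain ⟨i, j⟩ := p
  fin_cases i <;> fin_cases j <;>
    simp [f0, f1, f2, f3, h, x0, x1, x2, x3, y0, y1, y2, y3, z0, z1, z2, z3] <;> ring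

/-- Schmidt normal form of a two-qubit isometry: after a Takagi factorization of the symmetric
matrix `⟨w̃ᵢ|wⱼ⟩`, where `w̃ᵢ` is the spin flip of the column `wᵢ`, the real and imaginary parts
of the two columns, in magic coordinates, are four pairwise orthogonal real vectors. -/
theorem exists_eq_kronecker_mul_schmidtForm_mul {W : Matrix (Fin 2 × Fin 2) (Fin 2) ℂ}
    (hW : Wᴴ * W = 1) :
    ∃ a ∈ Matrix.specialUnitaryGroup (Fin 2) ℂ, ∃ b ∈ Matrix.specialUnitaryGroup (Fin 2) ℂ,
    ∃ u ∈ Matrix.unitaryGroup (Fin 2) ℂ, ∃ p q r s : ℝ, p ^ 2 + q ^ 2 = 1 ∧ r ^ 2 + s ^ 2 = 1 ∧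
      W = (a ⊗ₖ b) * schmidtForm p q r s * u := by
  obtain ⟨u, hu, s, t, hst⟩ := exists_unitary_transpose_mul_mul_eq_diagonal
    (Q := (spinFlip W)ᴴ * W) (by
      simp [Matrix.mul_apply, Fintype.sum_prod_type, spinFlip_apply]
      ring)
  have huu := Matrix.mem_unitaryGroup_iff'.1 hu
  obtain ⟨W', hW'⟩ : ∃ W', W' = W * u := ⟨_, rfl⟩
  have h1 : W'ᴴ * W' = 1 := by
    rw [hW', Matrix.conjTranspose_mul, Matrix.mul_assoc, ← Matrix.mul_assoc Wᴴ, hW, Matrix.one_mul,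
      ← Matrix.star_eq_conjTranspose, huu]
  have h2 : (spinFlip W')ᴴ * W' = Matrix.diagonal ![(s : ℂ), (t : ℂ)] := by
    have : (u.map star)ᴴ = uᵀ := by
      ext i j
      simp
    rw [hW', spinFlip_mul, Matrix.conjTranspose_mul, this, ← hst]
    simp only [Matrix.mul_assoc]
  choose x y hxy using fun a : Fin 2 => exists_eq_magicVec_add fun p => W' p a
  have hcol : ∀ a p, W' p a = (magicVec (x a) + Complex.I • magicVec (y a)) p :=
    fun a p => congrFun (hxy a) p
  have hflip := fun a => spinFlip_eq_of_magicVec (hcol a)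
  have g1 : ∀ a b, (1 : QubitOp) a b = ((inner ℝ (x a) (x b) + inner ℝ (y a) (y b) : ℝ) : ℂ) +
      ((inner ℝ (x a) (y b) - inner ℝ (y a) (x b) : ℝ) : ℂ) * Complex.I := fun a b => by
    rw [← h1, ← dotProduct_magicVec_add, ← hxy, ← hxy]
    rfl
  have g2 : ∀ a b, Matrix.diagonal ![(s : ℂ), (t : ℂ)] a b =
      ((inner ℝ (x a) (x b) - inner ℝ (y a) (y b) : ℝ) : ℂ) +
      ((inner ℝ (x a) (y b) + inner ℝ (y a) (x b) : ℝ) : ℂ) * Complex.I := fun a b => by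
    have := dotProduct_magicVec_add (x a) (-y a) (x b) (y b)
    rw [inner_neg_left, inner_neg_left, ← sub_eq_add_neg, sub_neg_eq_add] at this
    rw [← h2, ← this, ← hxy, ← funext (hflip a)]
    rfl
  have hre : ∀ a b : ℝ, ((a : ℂ) + b * Complex.I).re = a := fun a b => by simp
  have him : ∀ a b : ℝ, ((a : ℂ) + b * Complex.I).im = b := fun a b => by simp
  have k1 := fun a b => Complex.ext_iff.1 (g1 a b)
  have k2 := fun a b => Complex.ext_iff.1 (g2 a b)
  simp only [hre, him] at k1 k2
  have c00 := real_inner_comm (x 0) (y 0)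
  have c11 := real_inner_comm (x 1) (y 1)
  have k100 := k1 0 0
  have k101 := k1 0 1
  have k111 := k1 1 1
  have k200 := k2 0 0
  have k201 := k2 0 1
  have k211 := k2 1 1
  simp at k100 k101 k111 k200 k201 k211
  have e01 : inner ℝ (x 0) (y 0) = (0 : ℝ) := by linarith
  have e23 : inner ℝ (x 1) (y 1) = (0 : ℝ) := by linarith
  have e02 : inner ℝ (x 0) (x 1) = (0 : ℝ) := by linarith
  have e03 : inner ℝ (x 0) (y 1) = (0 : ℝ) := by linarith
  have e12 : inner ℝ (y 0) (x 1) = (0 : ℝ) := by linarith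
  have e13 : inner ℝ (y 0) (y 1) = (0 : ℝ) := by linarith
  obtain ⟨b, c, hbc⟩ := exists_orthonormalBasis_of_pairwise_inner_eq_zero
    ![x 0, y 0, x 1, y 1] (by
      intro i j hij
      fin_cases i <;> fin_cases j <;>
        first
        | exact absurd rfl hij
        | assumption
        | (rw [real_inner_comm]; assumption))
  have b0 : x 0 = c 0 • b 0 := hbc 0
  have b1 : y 0 = c 1 • b 1 := hbc 1
  have b2 : x 1 = c 2 • b 2 := hbc 2
  have b3 : y 1 = c 3 • b 3 := hbc 3
  have n01 : c 0 ^ 2 + c 1 ^ 2 = 1 := by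
    have := k100.1
    rw [b0, b1, norm_smul, norm_smul, b.orthonormal.1, b.orthonormal.1] at this
    simpa using this.symm
  have n23 : c 2 ^ 2 + c 3 ^ 2 = 1 := by
    have := k111.1
    rw [b2, b3, norm_smul, norm_smul, b.orthonormal.1, b.orthonormal.1] at this
    simpa using this.symm
  obtain ⟨g, hg, hgb⟩ := exists_isLocalOrSwap_magicVec_eq b
  have r2 : (Real.sqrt 2)⁻¹ ^ 2 = 1 / 2 := by
    rw [inv_pow, Real.sq_sqrt (by norm_num)]
    norm_num
  -- In terms of the magic basis, the two columns are `c₀ Φ₁ + i c₁ Φ₂` and `c₂ Φ₃ + i c₃ Φ₄`.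
  have hWg : W' = g * schmidtForm (((Real.sqrt 2)⁻¹ * (c 0 + c 1) : ℝ))
      (((Real.sqrt 2)⁻¹ * (c 0 - c 1) : ℝ)) (((Real.sqrt 2)⁻¹ * (c 3 - c 2) : ℝ))
      (((Real.sqrt 2)⁻¹ * (c 2 + c 3) : ℝ)) := by
    have hI := Complex.I_mul_I
    ext p a
    fin_cases a
    · simp only [Fin.zero_eta, hcol, b0, b1, magicVec_smul, hgb, ← Matrix.mulVec_smul,
        ← Matrix.mulVec_add]
      rw [Matrix.mulVec, Matrix.mul_apply]
      refine Finset.sum_congr rfl fun z _ => ?_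
      congr 1
      obtain ⟨i, j⟩ := z
      fin_cases i <;> fin_cases j <;> simp [magicBasis, ket, schmidtForm]
      · linear_combination -((Real.sqrt 2 : ℝ) : ℂ)⁻¹ * c 1 * hI
      · linear_combination ((Real.sqrt 2 : ℝ) : ℂ)⁻¹ * c 1 * hI
    · simp only [Fin.mk_one, hcol, b2, b3, magicVec_smul, hgb, ← Matrix.mulVec_smul,
        ← Matrix.mulVec_add]
      rw [Matrix.mulVec, Matrix.mul_apply]
      refine Finset.sum_congr rfl fun z _ => ?_
      congr 1
      obtain ⟨i, j⟩ := z
      fin_cases i <;> fin_cases j <;> simp [magicBasis, ket, schmidtForm]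
      · linear_combination -((Real.sqrt 2 : ℝ) : ℂ)⁻¹ * c 3 * hI
      · linear_combination -((Real.sqrt 2 : ℝ) : ℂ)⁻¹ * c 3 * hI
  have hWW : W = W' * star u := by
    rw [hW', Matrix.mul_assoc, Matrix.mem_unitaryGroup_iff.1 hu, Matrix.mul_one]
  obtain ⟨a, ha, a', ha', rfl | rfl⟩ := hg
  · refine ⟨a, ha, a', ha', star u, Unitary.star_mem hu, _, _, _, _, ?_, ?_, by rw [hWW, hWg]⟩
    · linear_combination 2 * (c 0 ^ 2 + c 1 ^ 2) * r2 + n01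
    · linear_combination 2 * (c 2 ^ 2 + c 3 ^ 2) * r2 + n23
  · have hsw : ∀ p q r s : ℂ, swapGate * schmidtForm p q r s = schmidtForm p q s r :=
      fun p q r s => by
        ext ⟨i, j⟩ k
        rw [swapGate_mul_apply]
        fin_cases i <;> fin_cases j <;> rfl
    refine ⟨a, ha, a', ha', star u, Unitary.star_mem hu, _, _, _, _, ?_, ?_, by
      rw [hWW, hWg, Matrix.mul_assoc (a ⊗ₖ a'), hsw]⟩
    · linear_combination 2 * (c 0 ^ 2 + c 1 ^ 2) * r2 + n01
    · linear_combination 2 * (c 2 ^ 2 + c 3 ^ 2) * r2 + n23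

/-- A two-qubit isometry of nonpositive orientation induces an anti-degradable channel. -/
theorem antiDegrades_of_orientation_nonpos {W : Matrix (Fin 2 × Fin 2) (Fin 2) ℂ}
    (hW : Wᴴ * W = 1) (h : (orientation W).re ≤ 0) : AntiDegrades W := by
  obtain ⟨a, ha, b, hb, u, hu, p, q, r, s, hpq, hrs, rfl⟩ :=
    exists_eq_kronecker_mul_schmidtForm_mul hW
  rw [orientation_mul hu, orientation_kronecker_mul ha hb, orientation_schmidtForm,
    Complex.ofReal_re] at h
  exact (antiDegrades_schmidtForm hpq hrs h).local
    (Matrix.mem_specialUnitaryGroup_iff.1 ha).1 (Matrix.mem_specialUnitaryGroup_iff.1 hb).1 u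

/-! ### Gates diagonal in the magic basis -/

/-- The gate with eigenvalues `d k` on the magic basis. -/
def magicDiag (d : Fin 4 → ℂ) : TwoQubitOp :=
  ∑ k, d k • ketbra (magicBasis k)

/-- The matrix whose columns are the magic basis. -/
def magicMatrix : Matrix (Fin 2 × Fin 2) (Fin 4) ℂ :=
  Matrix.of fun p k => magicBasis k p

theorem magicMatrix_conjTranspose_mul : magicMatrixᴴ * magicMatrix = 1 := by
  ext j k
  have h := star_magicVec_dotProduct (EuclideanSpace.single j 1) (EuclideanSpace.single k 1)
  rw [magicVec_single, magicVec_single] at h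
  refine Eq.trans h ?_
  rw [EuclideanSpace.inner_single_left, Matrix.one_apply]
  split_ifs with hjk <;> simp [hjk]

theorem magicMatrix_mul_conjTranspose : magicMatrix * magicMatrixᴴ = 1 :=
  (Matrix.mul_eq_one_comm_of_card_eq _ _ _ (by simp)).1 magicMatrix_conjTranspose_mul

theorem magicDiag_eq (d : Fin 4 → ℂ) :
    magicDiag d = magicMatrix * Matrix.diagonal d * magicMatrixᴴ := by
  ext p q
  rw [Matrix.mul_apply]
  simp only [magicDiag, Matrix.sum_apply, Matrix.smul_apply, ketbra, Matrix.vecMulVec_apply,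
    Matrix.mul_diagonal, Matrix.conjTranspose_apply, magicMatrix,
    Matrix.of_apply, smul_eq_mul, Pi.star_apply]
  exact Finset.sum_congr rfl fun k _ => by ring

theorem magicDiag_mul (d e : Fin 4 → ℂ) : magicDiag d * magicDiag e = magicDiag (d * e) := by
  rw [magicDiag_eq, magicDiag_eq, magicDiag_eq]
  calc _ = magicMatrix * Matrix.diagonal d * (magicMatrixᴴ * magicMatrix) * Matrix.diagonal e *
        magicMatrixᴴ := by simp only [Matrix.mul_assoc]
    _ = _ := by
      rw [magicMatrix_conjTranspose_mul, Matrix.mul_one, Matrix.mul_assoc magicMatrix,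
        Matrix.diagonal_mul_diagonal]
      rfl

theorem magicDiag_conjTranspose (d : Fin 4 → ℂ) : (magicDiag d)ᴴ = magicDiag (star d) := by
  rw [magicDiag_eq, magicDiag_eq, Matrix.conjTranspose_mul, Matrix.conjTranspose_mul,
    Matrix.conjTranspose_conjTranspose, Matrix.diagonal_conjTranspose, Matrix.mul_assoc]

theorem magicDiag_one : magicDiag 1 = 1 := by
  rw [magicDiag_eq, Matrix.diagonal_one', Matrix.mul_one, magicMatrix_mul_conjTranspose]

theorem magicDiag_mem_unitaryGroup {d : Fin 4 → ℂ} (hd : ∀ k, ‖d k‖ = 1) :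
    magicDiag d ∈ Matrix.unitaryGroup (Fin 2 × Fin 2) ℂ := by
  rw [Matrix.mem_unitaryGroup_iff, Matrix.star_eq_conjTranspose, magicDiag_conjTranspose,
    magicDiag_mul, ← magicDiag_one]
  congr 1
  ext k
  simp [Complex.mul_conj, Complex.normSq_eq_norm_sq, hd]

theorem IsLocalOrSwap.mem_unitaryGroup {g : TwoQubitOp} (hg : IsLocalOrSwap g) :
    g ∈ Matrix.unitaryGroup (Fin 2 × Fin 2) ℂ := by
  obtain ⟨a, ha, b, hb, rfl | rfl⟩ := hg
  · exact kronecker_mem_unitaryGroup ha.1 hb.1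
  · exact mul_mem (kronecker_mem_unitaryGroup ha.1 hb.1) swapGate_mem_unitaryGroup

theorem magicDiag_entries (d : Fin 4 → ℂ) :
    magicDiag d = Matrix.of fun x y =>
      (![![![![(d 0 + d 1) / 2, 0], ![0, (d 0 - d 1) / 2]],
          ![![0, (d 2 + d 3) / 2], ![(d 3 - d 2) / 2, 0]]],
        ![![![0, (d 3 - d 2) / 2], ![(d 2 + d 3) / 2, 0]],
          ![![(d 0 - d 1) / 2, 0], ![0, (d 0 + d 1) / 2]]]] : _) x.1 x.2 y.1 y.2 := by
  have h := inv_sqrt_two_mul_self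
  have hI := Complex.I_mul_I
  let r := ((Real.sqrt 2 : ℝ) : ℂ)⁻¹
  ext ⟨i, j⟩ ⟨k, l⟩
  fin_cases i <;> fin_cases j <;> fin_cases k <;> fin_cases l <;>
    simp [magicDiag, Fin.sum_univ_four, ketbra, Matrix.vecMulVec_apply, magicBasis, ket,
      div_eq_mul_inv]
  · linear_combination (d 0 + d 1) * h - d 1 * r * r * hI
  · linear_combination (d 0 - d 1) * h + d 1 * r * r * hI
  · linear_combination (d 2 + d 3) * h - d 3 * r * r * hI
  · linear_combination (d 3 - d 2) * h - d 3 * r * r * hI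
  · linear_combination (d 3 - d 2) * h - d 3 * r * r * hI
  · linear_combination (d 2 + d 3) * h - d 3 * r * r * hI
  · linear_combination (d 0 - d 1) * h + d 1 * r * r * hI
  · linear_combination (d 0 + d 1) * h - d 1 * r * r * hI

/-- The swap gate is `-1` on the singlet and `1` on its complement. -/
theorem swapGate_mul_magicDiag (d : Fin 4 → ℂ) :
    swapGate * magicDiag d = magicDiag ![d 0, d 1, -d 2, d 3] := by
  rw [magicDiag_entries, magicDiag_entries]
  ext ⟨i, j⟩ ⟨k, l⟩
  rw [swapGate_mul_apply]
  fin_cases i <;> fin_cases j <;> fin_cases k <;> fin_cases l <;> simp <;> ring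

theorem IsLocalOrSwap.exists_eq_kronecker_mul_magicDiag {g : TwoQubitOp} (hg : IsLocalOrSwap g) :
    ∃ a ∈ Matrix.unitaryGroup (Fin 2) ℂ, ∃ b ∈ Matrix.unitaryGroup (Fin 2) ℂ,
      ∃ s : Fin 4 → ℂ, (∀ k, ‖s k‖ = 1) ∧ g = (a ⊗ₖ b) * magicDiag s := by
  obtain ⟨a, ha, b, hb, rfl | rfl⟩ := hg
  · exact ⟨a, ha.1, b, hb.1, 1, fun k => by simp, by rw [magicDiag_one, Matrix.mul_one]⟩
  · refine ⟨a, ha.1, b, hb.1, ![1, 1, -1, 1], fun k => by fin_cases k <;> simp, ?_⟩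
    rw [← Matrix.mul_one swapGate, ← magicDiag_one, swapGate_mul_magicDiag]
    rfl

/-! ### The Cartan decomposition of two-qubit unitaries -/

/-- Two commuting symmetric operators on a finite-dimensional real inner product space have an
orthonormal basis of common eigenvectors. -/
theorem exists_orthonormalBasis_common_eigenvectors {E : Type} [NormedAddCommGroup E]
    [InnerProductSpace ℝ E] [FiniteDimensional ℝ E] {n : ℕ} (hn : Module.finrank ℝ E = n)
    {S T : E →ₗ[ℝ] E} (hS : S.IsSymmetric) (hT : T.IsSymmetric) (hST : Commute T S) :
    ∃ b : OrthonormalBasis (Fin n) ℝ E, ∀ i, (∃ s : ℝ, S (b i) = s • b i) ∧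
      ∃ t : ℝ, T (b i) = t • b i := by
  classical
  have hinv : ∀ μ : ℝ, ∀ v ∈ Module.End.eigenspace T μ, S v ∈ Module.End.eigenspace T μ :=
    fun μ => Module.End.mapsTo_genEigenspace_of_comm hST μ 1
  let A : Module.End.Eigenvalues T → Submodule ℝ E := fun μ => Module.End.eigenspace T (μ : ℝ)
  have hA : DirectSum.IsInternal A := hT.direct_sum_isInternal
  have hO : OrthogonalFamily ℝ (fun μ => A μ) fun μ => (A μ).subtypeₗᵢ :=
    hT.orthogonalFamily_eigenspaces.comp Subtype.val_injective
  let v := fun μ : Module.End.Eigenvalues T =>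
    (hS.restrict_invariant (hinv μ)).eigenvectorBasis (E := A μ) rfl
  let b := hA.collectedOrthonormalBasis hO v
  let e := Fintype.equivFinOfCardEq ((Module.finrank_eq_card_basis b.toBasis).symm.trans hn)
  refine ⟨b.reindex e, fun i => ?_⟩
  rw [OrthonormalBasis.reindex_apply]
  generalize e.symm i = a
  constructor
  · have hb : b a = (v a.1 a.2 : E) := by
      simp [b, DirectSum.IsInternal.collectedOrthonormalBasis]
    have h := (hS.restrict_invariant (hinv a.1)).apply_eigenvectorBasis (E := A a.1) rfl a.2
    rw [hb]
    exact ⟨_, congrArg Subtype.val h⟩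
  · exact ⟨a.1, Module.End.mem_eigenspace_iff.1 (hA.collectedOrthonormalBasis_mem hO v a)⟩

/-- A symmetric unitary matrix has a real orthonormal basis of eigenvectors, since its real and
imaginary parts commute. -/
theorem exists_real_eigenbasis_of_symmetric_unitary {n : ℕ} {P : Matrix (Fin n) (Fin n) ℂ}
    (hP : Pᵀ = P) (hU : P ∈ Matrix.unitaryGroup (Fin n) ℂ) :
    ∃ b : OrthonormalBasis (Fin n) ℝ (EuclideanSpace ℝ (Fin n)), ∃ μ : Fin n → ℂ,
      ∀ i, P *ᵥ (fun j => (b i j : ℂ)) = μ i • fun j => (b i j : ℂ) := by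
  let X : Matrix (Fin n) (Fin n) ℝ := P.map Complex.re
  let Y : Matrix (Fin n) (Fin n) ℝ := P.map Complex.im
  have hX : X.IsHermitian := by
    ext i j
    simpa [X] using congrArg Complex.re (congrFun₂ hP i j)
  have hY : Y.IsHermitian := by
    ext i j
    simpa [Y] using congrArg Complex.im (congrFun₂ hP i j)
  have hXY : Y * X = X * Y := by
    have h1 := Matrix.mem_unitaryGroup_iff.1 hU
    ext i j
    have h2 := congrArg Complex.im (congrFun₂ h1 i j)
    have h3 : ((1 : Matrix (Fin n) (Fin n) ℂ) i j).im = 0 := by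
      rw [Matrix.one_apply]; split_ifs <;> simp
    have h4 : ∀ i j, P j i = P i j := fun i j => congrFun₂ hP i j
    rw [h3, Matrix.mul_apply, Complex.im_sum] at h2
    simp only [Matrix.star_apply, Complex.star_def, Complex.mul_im, Complex.conj_re,
      Complex.conj_im, Finset.sum_add_distrib] at h2
    simp only [Matrix.mul_apply, X, Y, Matrix.map_apply]
    rw [← sub_eq_zero, ← h2, add_comm, sub_eq_add_neg, ← Finset.sum_neg_distrib]
    congr 1
    · exact Finset.sum_congr rfl fun k _ => by rw [h4 k j]
    · exact Finset.sum_congr rfl fun k _ => by rw [h4 k j]; ring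
  obtain ⟨b, hb⟩ := exists_orthonormalBasis_common_eigenvectors (n := n) (by simp)
    (Matrix.isSymmetric_toEuclideanLin_iff.2 hX) (Matrix.isSymmetric_toEuclideanLin_iff.2 hY) (by
      rw [commute_iff_eq, Module.End.mul_eq_comp, Module.End.mul_eq_comp]
      rw [← Matrix.toLpLin_mul_same, ← Matrix.toLpLin_mul_same, hXY])
  choose s hs using fun i => (hb i).1
  choose t ht using fun i => (hb i).2
  refine ⟨b, fun i => s i + t i * Complex.I, fun i => ?_⟩
  have hs' : X *ᵥ (b i).ofLp = s i • (b i).ofLp := congrArg WithLp.ofLp (hs i)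
  have ht' : Y *ᵥ (b i).ofLp = t i • (b i).ofLp := congrArg WithLp.ofLp (ht i)
  ext j
  have hs'' := congrFun hs' j
  have ht'' := congrFun ht' j
  simp only [Matrix.mulVec, dotProduct, X, Y, Matrix.map_apply, Pi.smul_apply,
    smul_eq_mul] at hs'' ht''
  apply Complex.ext
  · simp [Matrix.mulVec, dotProduct, hs'']
  · simp [Matrix.mulVec, dotProduct, ht'']

/-- Cartan decomposition: every two-qubit unitary is locally equivalent to one that is diagonal in
the magic basis. In magic coordinates, where local unitaries become real orthogonal, the symmetric
unitary `Vᵀ V` is diagonalized by a real orthonormal basis, which `V` maps to a real orthonormal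
basis up to phases. -/
theorem exists_locallyEquiv_magicDiag {V : TwoQubitOp}
    (hV : V ∈ Matrix.unitaryGroup (Fin 2 × Fin 2) ℂ) :
    ∃ d : Fin 4 → ℂ, (∀ k, ‖d k‖ = 1) ∧ LocallyEquiv V (magicDiag d) := by
  have hV1 : Vᴴ * V = 1 := Matrix.mem_unitaryGroup_iff'.1 hV
  obtain ⟨V', hV'⟩ : ∃ V', V' = magicMatrixᴴ * V * magicMatrix := ⟨_, rfl⟩
  have hVV : V * magicMatrix = magicMatrix * V' := by
    rw [hV', ← Matrix.mul_assoc, ← Matrix.mul_assoc, magicMatrix_mul_conjTranspose, Matrix.one_mul]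
  have hU : V'ᴴ * V' = 1 := by
    have : V'ᴴ * V' = (magicMatrix * V')ᴴ * (magicMatrix * V') := by
      rw [Matrix.conjTranspose_mul, Matrix.mul_assoc, ← Matrix.mul_assoc magicMatrixᴴ,
        magicMatrix_conjTranspose_mul, Matrix.one_mul]
    rw [this, ← hVV, Matrix.conjTranspose_mul, Matrix.mul_assoc, ← Matrix.mul_assoc Vᴴ, hV1,
      Matrix.one_mul, magicMatrix_conjTranspose_mul]
  have hP : V'ᵀ * V' ∈ Matrix.unitaryGroup (Fin 4) ℂ := by
    refine mul_mem ?_ (Matrix.mem_unitaryGroup_iff'.2 hU)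
    rw [Matrix.mem_unitaryGroup_iff]
    have := congrArg Matrix.transpose hU
    rw [Matrix.transpose_mul, Matrix.transpose_one] at this
    exact this
  obtain ⟨c, μ, hc⟩ := exists_real_eigenbasis_of_symmetric_unitary
    (by rw [Matrix.transpose_mul, Matrix.transpose_transpose]) hP
  let C : Matrix (Fin 4) (Fin 4) ℂ := Matrix.of fun i k => (c k i : ℂ)
  have hCt : Cᴴ = Cᵀ := by
    ext i j
    simp [C]
  have hC : Cᵀ * C = 1 := by
    ext j k
    have := orthonormal_iff_ite.1 c.orthonormal j k
    rw [PiLp.inner_apply] at this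
    simp only [RCLike.inner_apply, conj_trivial] at this
    rw [Matrix.mul_apply, Matrix.one_apply]
    simp only [C, Matrix.transpose_apply, Matrix.of_apply, ← Complex.ofReal_mul,
      ← Complex.ofReal_sum]
    rw [← Complex.ofReal_one, ← Complex.ofReal_zero, ← apply_ite Complex.ofReal, ← this]
    simp only [mul_comm]
  have hC' : C * Cᵀ = 1 := mul_eq_one_comm.1 hC
  have hPC : V'ᵀ * V' * C = C * Matrix.diagonal μ := by
    ext i k
    rw [Matrix.mul_diagonal]
    exact (congrFun (hc k) i).trans (mul_comm _ _)
  have hμ : ∀ k, ‖μ k‖ = 1 := by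
    have hd : Matrix.diagonal μ ∈ Matrix.unitaryGroup (Fin 4) ℂ := by
      have : Matrix.diagonal μ = Cᵀ * (V'ᵀ * V') * C := by
        rw [Matrix.mul_assoc, hPC, ← Matrix.mul_assoc, hC, Matrix.one_mul]
      rw [this]
      have hCU : C ∈ Matrix.unitaryGroup (Fin 4) ℂ := by
        rw [Matrix.mem_unitaryGroup_iff', Matrix.star_eq_conjTranspose, hCt, hC]
      refine mul_mem (mul_mem ?_ hP) hCU
      rw [← hCt]
      exact Unitary.star_mem hCU
    intro k
    have := congrFun₂ (Matrix.mem_unitaryGroup_iff.1 hd) k k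
    rw [Matrix.star_eq_conjTranspose, Matrix.diagonal_conjTranspose,
      Matrix.diagonal_mul_diagonal, Matrix.diagonal_apply_eq, Matrix.one_apply_eq, Pi.star_apply,
      Complex.star_def, Complex.mul_conj, Complex.normSq_eq_norm_sq] at this
    have h2 : ‖μ k‖ ^ 2 = 1 := by exact_mod_cast this
    exact (pow_eq_one_iff_of_nonneg (norm_nonneg _) two_ne_zero).1 h2
  choose d hd using fun k => IsAlgClosed.exists_pow_nat_eq (μ k) (n := 2) two_pos
  have hdn : ∀ k, ‖d k‖ = 1 := fun k => by
    have := congrArg norm (hd k)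
    rw [norm_pow, hμ] at this
    exact (pow_eq_one_iff_of_nonneg (norm_nonneg _) two_ne_zero).1 this
  have hdd : ∀ k, d k * star (d k) = 1 := fun k => by
    rw [Complex.star_def, Complex.mul_conj, Complex.normSq_eq_norm_sq, hdn]
    norm_num
  have hdμ : Matrix.diagonal (star d) * Matrix.diagonal μ * Matrix.diagonal (star d) =
      (1 : Matrix (Fin 4) (Fin 4) ℂ) := by
    rw [Matrix.diagonal_mul_diagonal, Matrix.diagonal_mul_diagonal, ← Matrix.diagonal_one]
    congr 1
    ext k
    rw [← hd k, Pi.star_apply]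
    linear_combination (d k * star (d k) + 1) * hdd k
  have hd1 : Matrix.diagonal d * Matrix.diagonal (star d) = (1 : Matrix (Fin 4) (Fin 4) ℂ) := by
    rw [Matrix.diagonal_mul_diagonal, ← Matrix.diagonal_one]
    congr 1
    ext k
    exact hdd k
  let K := V' * C * Matrix.diagonal (star d)
  have hKt : Kᵀ * K = 1 := by
    calc Kᵀ * K = Matrix.diagonal (star d) * Cᵀ * (V'ᵀ * V' * C) * Matrix.diagonal (star d) := by
          simp only [K, Matrix.transpose_mul, Matrix.diagonal_transpose, Matrix.mul_assoc]
      _ = Matrix.diagonal (star d) * (Cᵀ * C) * Matrix.diagonal μ * Matrix.diagonal (star d) := by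
          rw [hPC]; simp only [Matrix.mul_assoc]
      _ = 1 := by rw [hC, Matrix.mul_one, hdμ]
  have hKh : Kᴴ * K = 1 := by
    calc Kᴴ * K = Matrix.diagonal d * Cᴴ * (V'ᴴ * V') * C * Matrix.diagonal (star d) := by
          simp only [K, Matrix.conjTranspose_mul, Matrix.diagonal_conjTranspose, star_star,
            Matrix.mul_assoc]
      _ = 1 := by
          rw [hU, Matrix.mul_one, hCt, Matrix.mul_assoc (Matrix.diagonal d), hC, Matrix.mul_one,
            hd1]
  -- `K` is unitary with `Kᵀ K = 1`, hence real.
  have hreal : ∀ i k, ((K i k).re : ℂ) = K i k := fun i k => by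
    have : Kᵀ = Kᴴ := by
      rw [← Matrix.mul_one Kᵀ, ← mul_eq_one_comm.1 hKh, ← Matrix.mul_assoc, hKt,
        Matrix.one_mul]
    exact Complex.conj_eq_iff_re.1 (congrFun₂ this k i).symm
  have hbo : Orthonormal ℝ ((Set.univ : Set (Fin 4)).domRestrict fun k =>
      (WithLp.toLp 2 fun i => (K i k).re : EuclideanSpace ℝ (Fin 4))) := by
    rw [orthonormal_iff_ite]
    rintro ⟨j, -⟩ ⟨k, -⟩
    have h := congrFun₂ hKt j k
    simp only [Matrix.mul_apply, Matrix.transpose_apply] at h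
    simp only [Set.domRestrict_apply, PiLp.inner_apply, RCLike.inner_apply, conj_trivial,
      Subtype.mk.injEq]
    apply Complex.ofReal_injective
    push_cast
    simp only [hreal]
    rw [apply_ite Complex.ofReal, Complex.ofReal_one, Complex.ofReal_zero, ← Matrix.one_apply, ← h]
    simp only [mul_comm]
  obtain ⟨b, hb⟩ := hbo.exists_orthonormalBasis_extension_of_card_eq (by simp)
  obtain ⟨g, hg, hgb⟩ := exists_isLocalOrSwap_magicVec_eq b
  obtain ⟨h, hh, hhc⟩ := exists_isLocalOrSwap_magicVec_eq c
  have hmv : ∀ x : EuclideanSpace ℝ (Fin 4), magicVec x = magicMatrix *ᵥ fun k => (x k : ℂ) := by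
    intro x
    ext p
    simp only [magicVec, Finset.sum_apply, Pi.smul_apply, smul_eq_mul, Matrix.mulVec, dotProduct,
      magicMatrix, Matrix.of_apply, mul_comm]
  have hgK : g * magicMatrix = magicMatrix * K := by
    ext p k
    refine (congrFun (hgb k) p).symm.trans ?_
    rw [hmv, hb k (Set.mem_univ k)]
    simp only [hreal]
    rfl
  have hhC : h * magicMatrix = magicMatrix * C := by
    ext p k
    refine (congrFun (hhc k) p).symm.trans ?_
    rw [hmv]
    rfl
  have hVg : V * h = g * magicDiag d := by
    calc V * h = V * (h * magicMatrix) * magicMatrixᴴ := by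
          rw [Matrix.mul_assoc, Matrix.mul_assoc, magicMatrix_mul_conjTranspose, Matrix.mul_one]
      _ = magicMatrix * (V' * C) * magicMatrixᴴ := by
          rw [hhC, ← Matrix.mul_assoc, hVV]; simp only [Matrix.mul_assoc]
      _ = magicMatrix * (K * Matrix.diagonal d) * magicMatrixᴴ := by
          congr 2
          simp only [K]
          rw [Matrix.mul_assoc _ (Matrix.diagonal (star d)), mul_eq_one_comm.1 hd1,
            Matrix.mul_one]
      _ = g * magicDiag d := by
          rw [magicDiag_eq, ← Matrix.mul_assoc g, ← Matrix.mul_assoc g, hgK]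
          simp only [Matrix.mul_assoc]
  have hVeq : V = g * magicDiag d * hᴴ := by
    rw [← hVg, Matrix.mul_assoc, ← Matrix.star_eq_conjTranspose,
      Matrix.mem_unitaryGroup_iff.1 hh.mem_unitaryGroup, Matrix.mul_one]
  obtain ⟨a, ha, a', ha', s, hs, rfl⟩ := hg.exists_eq_kronecker_mul_magicDiag
  obtain ⟨e, he, e', he', t, ht, rfl⟩ := hh.exists_eq_kronecker_mul_magicDiag
  refine ⟨s * d * star t, fun k => ?_, a, ha, a', ha', star e, Unitary.star_mem he, star e',
    Unitary.star_mem he', ?_⟩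
  · rw [Pi.mul_apply, Pi.mul_apply, Pi.star_apply, norm_mul, norm_mul, norm_star, hs, hdn, ht]
    norm_num
  · rw [hVeq, Matrix.conjTranspose_mul, magicDiag_conjTranspose, Matrix.conjTranspose_kronecker,
      ← magicDiag_mul, ← magicDiag_mul]
    simp only [Matrix.mul_assoc, Matrix.star_eq_conjTranspose]

/-! ### Local equivalences between magic-diagonal gates -/

theorem LocallyEquiv.refl (V : TwoQubitOp) : LocallyEquiv V V :=
  ⟨1, one_mem _, 1, one_mem _, 1, one_mem _, 1, one_mem _, by
    rw [Matrix.one_kronecker_one, Matrix.one_mul, Matrix.mul_one]⟩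

theorem locallyEquiv_smul {c : ℂ} (hc : ‖c‖ = 1) (V : TwoQubitOp) : LocallyEquiv (c • V) V := by
  refine ⟨c • 1, ?_, 1, one_mem _, 1, one_mem _, 1, one_mem _, ?_⟩
  · rw [Matrix.mem_unitaryGroup_iff]
    have : star c * c = 1 := by
      rw [mul_comm, Complex.star_def, Complex.mul_conj, Complex.normSq_eq_norm_sq, hc]
      norm_num
    rw [star_smul, star_one, smul_mul_smul_comm, Matrix.one_mul, mul_comm, this, one_smul]
  · rw [Matrix.smul_kronecker, Matrix.one_kronecker_one, Matrix.smul_mul, Matrix.one_mul,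
      Matrix.mul_one]

theorem magicDiag_smul (c : ℂ) (d : Fin 4 → ℂ) : magicDiag (c • d) = c • magicDiag d := by
  simp only [magicDiag, Finset.smul_sum, smul_smul, Pi.smul_apply, smul_eq_mul]

/-- A local unitary permuting the magic basis up to phases permutes the eigenvalues of a
magic-diagonal gate. -/
theorem locallyEquiv_magicDiag_comp {a b : QubitOp} (ha : a ∈ Matrix.unitaryGroup (Fin 2) ℂ)
    (hb : b ∈ Matrix.unitaryGroup (Fin 2) ℂ) {σ : Equiv.Perm (Fin 4)} {φ : Fin 4 → ℂ}
    (hφ : ∀ k, ‖φ k‖ = 1)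
    (h : ∀ k, (a ⊗ₖ b) *ᵥ magicBasis k = φ k • magicBasis (σ k)) (d : Fin 4 → ℂ) :
    LocallyEquiv (magicDiag d) (magicDiag (d ∘ σ)) := by
  refine ⟨a, ha, b, hb, star a, Unitary.star_mem ha, star b, Unitary.star_mem hb, ?_⟩
  have hk : ∀ k, (a ⊗ₖ b) * ketbra (magicBasis k) * (a ⊗ₖ b)ᴴ = ketbra (magicBasis (σ k)) := by
    intro k
    have hφ' : φ k * star (φ k) = 1 := by
      rw [Complex.star_def, Complex.mul_conj, Complex.normSq_eq_norm_sq, hφ]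
      norm_num
    rw [ketbra, Matrix.mul_vecMulVec, Matrix.vecMulVec_mul, ← Matrix.star_mulVec, h, ketbra]
    ext p q
    simp only [Matrix.vecMulVec_apply, Pi.smul_apply, Pi.star_apply, smul_eq_mul, star_mul']
    linear_combination (magicBasis (σ k) p * star (magicBasis (σ k) q)) * hφ'
  rw [Matrix.star_eq_conjTranspose, Matrix.star_eq_conjTranspose, ← Matrix.conjTranspose_kronecker]
  simp only [magicDiag, Finset.mul_sum, Finset.sum_mul, Matrix.mul_smul, Matrix.smul_mul, hk,
    Function.comp_apply]
  exact (Equiv.sum_comp σ fun k => d k • ketbra (magicBasis k)).symm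

/-- The gate `H ⊗ H`, with `H` the Hadamard gate, exchanges `Φ₂` and `Φ₄`. -/
theorem locallyEquiv_magicDiag_swap_one_three (d : Fin 4 → ℂ) :
    LocallyEquiv (magicDiag d) (magicDiag (d ∘ Equiv.swap 1 3)) := by
  have h2 := inv_sqrt_two_mul_self
  have hH : ((((Real.sqrt 2 : ℝ) : ℂ)⁻¹) • !![1, 1; 1, -1] : QubitOp) ∈
      Matrix.unitaryGroup (Fin 2) ℂ := by
    rw [Matrix.mem_unitaryGroup_iff]
    ext i j
    fin_cases i <;> fin_cases j <;> simp [Matrix.mul_apply]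
    · linear_combination 2 * h2
    · linear_combination 2 * h2
  refine locallyEquiv_magicDiag_comp hH hH (φ := ![1, 1, -1, 1])
    (fun k => by fin_cases k <;> simp) (fun k => ?_) d
  let r := ((Real.sqrt 2 : ℝ) : ℂ)⁻¹
  have s0 : Equiv.swap (1 : Fin 4) 3 0 = 0 := by decide
  have s2 : Equiv.swap (1 : Fin 4) 3 2 = 2 := by decide
  ext ⟨i, j⟩
  fin_cases k <;> fin_cases i <;> fin_cases j <;>
    simp [Matrix.mulVec, dotProduct, Fintype.sum_prod_type, magicBasis, ket, s0, s2]
  · linear_combination 2 * r * h2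
  · linear_combination 2 * r * h2
  · linear_combination 2 * (-Complex.I * r) * h2
  · linear_combination 2 * (-Complex.I * r) * h2
  · linear_combination -2 * r * h2
  · linear_combination 2 * r * h2
  · linear_combination 2 * (-Complex.I * r) * h2
  · linear_combination 2 * (Complex.I * r) * h2

/-- The gate `S ⊗ S`, with `S = diag(1, i)`, exchanges `Φ₁` and `Φ₂`. -/
theorem locallyEquiv_magicDiag_swap_zero_one (d : Fin 4 → ℂ) :
    LocallyEquiv (magicDiag d) (magicDiag (d ∘ Equiv.swap 0 1)) := by
  have hS : (!![1, 0; 0, Complex.I] : QubitOp) ∈ Matrix.unitaryGroup (Fin 2) ℂ := by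
    rw [Matrix.mem_unitaryGroup_iff]
    ext i j
    fin_cases i <;> fin_cases j <;> simp [Matrix.mul_apply]
  have s2 : Equiv.swap (0 : Fin 4) 1 2 = 2 := by decide
  have s3 : Equiv.swap (0 : Fin 4) 1 3 = 3 := by decide
  have hI := Complex.I_mul_I
  let r := ((Real.sqrt 2 : ℝ) : ℂ)⁻¹
  refine locallyEquiv_magicDiag_comp hS hS (φ := ![Complex.I, -Complex.I, Complex.I, Complex.I])
    (fun k => by fin_cases k <;> simp) (fun k => ?_) d
  ext ⟨i, j⟩
  fin_cases k <;> fin_cases i <;> fin_cases j <;>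
    simp [Matrix.mulVec, dotProduct, Fintype.sum_prod_type, magicBasis, ket, s2, s3]
  · linear_combination r * hI
  · linear_combination r * hI
  · ring
  · ring

/-- The gate `diag(1, i) ⊗ diag(1, -i)` exchanges `Φ₃` and `Φ₄`. -/
theorem locallyEquiv_magicDiag_swap_two_three (d : Fin 4 → ℂ) :
    LocallyEquiv (magicDiag d) (magicDiag (d ∘ Equiv.swap 2 3)) := by
  have hS : (!![1, 0; 0, Complex.I] : QubitOp) ∈ Matrix.unitaryGroup (Fin 2) ℂ := by
    rw [Matrix.mem_unitaryGroup_iff]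
    ext i j
    fin_cases i <;> fin_cases j <;> simp [Matrix.mul_apply]
  have hS' : (!![1, 0; 0, -Complex.I] : QubitOp) ∈ Matrix.unitaryGroup (Fin 2) ℂ := by
    rw [Matrix.mem_unitaryGroup_iff]
    ext i j
    fin_cases i <;> fin_cases j <;> simp [Matrix.mul_apply]
  have s0 : Equiv.swap (2 : Fin 4) 3 0 = 0 := by decide
  have s1 : Equiv.swap (2 : Fin 4) 3 1 = 1 := by decide
  have hI := Complex.I_mul_I
  let r := ((Real.sqrt 2 : ℝ) : ℂ)⁻¹
  refine locallyEquiv_magicDiag_comp hS hS' (φ := ![1, 1, 1, -1])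
    (fun k => by fin_cases k <;> simp) (fun k => ?_) d
  ext ⟨i, j⟩
  fin_cases k <;> fin_cases i <;> fin_cases j <;>
    simp [Matrix.mulVec, dotProduct, Fintype.sum_prod_type, magicBasis, ket, s0, s1]
  · ring
  · ring
  · linear_combination -r * hI
  · linear_combination -r * hI

/-- The gate `σ_z ⊗ σ_z` has eigenvalues `1, 1, -1, -1` on the magic basis. -/
theorem locallyEquiv_magicDiag_zz (d : Fin 4 → ℂ) :
    LocallyEquiv (magicDiag d) (magicDiag ![d 0, d 1, -d 2, -d 3]) := by
  have hZ : (!![1, 0; 0, -1] : QubitOp) ∈ Matrix.unitaryGroup (Fin 2) ℂ := by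
    rw [Matrix.mem_unitaryGroup_iff]
    ext i j
    fin_cases i <;> fin_cases j <;> simp [Matrix.mul_apply]
  refine ⟨_, hZ, _, hZ, 1, one_mem _, 1, one_mem _, ?_⟩
  rw [Matrix.one_kronecker_one, Matrix.mul_one, magicDiag_entries, magicDiag_entries]
  ext ⟨i, j⟩ ⟨k, l⟩
  fin_cases i <;> fin_cases j <;> fin_cases k <;> fin_cases l <;>
    simp [Matrix.mul_apply, Fintype.sum_prod_type] <;> ring

/-- The gate `σ_x ⊗ σ_x` has eigenvalues `1, -1, -1, 1` on the magic basis. -/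
theorem locallyEquiv_magicDiag_xx (d : Fin 4 → ℂ) :
    LocallyEquiv (magicDiag d) (magicDiag ![d 0, -d 1, -d 2, d 3]) := by
  have hX : (!![0, 1; 1, 0] : QubitOp) ∈ Matrix.unitaryGroup (Fin 2) ℂ := by
    rw [Matrix.mem_unitaryGroup_iff]
    ext i j
    fin_cases i <;> fin_cases j <;> simp [Matrix.mul_apply]
  refine ⟨_, hX, _, hX, 1, one_mem _, 1, one_mem _, ?_⟩
  rw [Matrix.one_kronecker_one, Matrix.mul_one, magicDiag_entries, magicDiag_entries]
  ext ⟨i, j⟩ ⟨k, l⟩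
  fin_cases i <;> fin_cases j <;> fin_cases k <;> fin_cases l <;>
    simp [Matrix.mul_apply, Fintype.sum_prod_type] <;> ring

theorem magicDiag_map_conj (d : Fin 4 → ℂ) :
    (magicDiag d).map (starRingEnd ℂ) = magicDiag (star d) := by
  rw [magicDiag_entries, magicDiag_entries]
  ext ⟨i, j⟩ ⟨k, l⟩
  fin_cases i <;> fin_cases j <;> fin_cases k <;> fin_cases l <;>
    simp [Complex.conj_ofNat]

/-! ### Universal anti-degradability of magic-diagonal gates -/

/-- The orientation is a sum over the squared Cartesian components of the Bloch vector of `η`, each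
weighted by the product of the cosines of the phase differences in one of the three pairings of
the magic basis (the eigenvalues `d k` being phases). -/
theorem orientation_magicDiag (d : Fin 4 → ℂ) (η : Fin 2 → ℂ) :
    orientation (magicDiag d * appendKet η) =
      (((Complex.normSq (η 0) - Complex.normSq (η 1)) ^ 2 *
          ((d 0 * star (d 1)).re * (d 2 * star (d 3)).re) +
        (2 * (η 0 * star (η 1)).im) ^ 2 * ((d 0 * star (d 2)).re * (d 1 * star (d 3)).re) +
        (2 * (η 0 * star (η 1)).re) ^ 2 * ((d 0 * star (d 3)).re * (d 1 * star (d 2)).re) : ℝ) :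
          ℂ) := by
  have hre : ∀ z w : ℂ, (((z * star w).re : ℝ) : ℂ) = (z * star w + star z * w) / 2 :=
    fun z w => by
      rw [Complex.re_eq_add_conj]
      simp
  have him : ∀ z w : ℂ, (((2 * (z * star w).im) ^ 2 : ℝ) : ℂ) =
      -(z * star w - star z * w) ^ 2 := fun z w => by
    have h : star z * w = (starRingEnd ℂ) (z * star w) := by simp
    rw [h, Complex.sub_conj]
    push_cast
    linear_combination (2 * ((z * star w).im : ℂ)) ^ 2 * Complex.I_sq
  have hW : magicDiag d * appendKet η = Matrix.of fun x a =>
      (![![![(d 0 + d 1) / 2 * η 0, (d 0 - d 1) / 2 * η 1],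
          ![(d 2 + d 3) / 2 * η 1, (d 3 - d 2) / 2 * η 0]],
        ![![(d 3 - d 2) / 2 * η 1, (d 2 + d 3) / 2 * η 0],
          ![(d 0 - d 1) / 2 * η 0, (d 0 + d 1) / 2 * η 1]]] : _) x.1 x.2 a := by
    rw [magicDiag_entries]
    ext ⟨i, j⟩ a
    fin_cases i <;> fin_cases j <;> fin_cases a <;>
      simp [Matrix.mul_apply, Fintype.sum_prod_type, appendKet]
  rw [orientation, det_twoQubitOp, det_fin_four, hW]
  have hre2 : ∀ z w : ℂ, (((2 * (z * star w).re) ^ 2 : ℝ) : ℂ) =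
      (z * star w + star z * w) ^ 2 := fun z w => by
    rw [Complex.ofReal_pow, Complex.ofReal_mul, hre]
    push_cast
    ring
  simp only [Complex.ofReal_add, Complex.ofReal_mul, him, hre2, hre]
  simp only [Complex.ofReal_pow, Complex.ofReal_sub, ← Complex.mul_conj]
  simp [flipFrame, spinFlip_apply]
  ring

/-- For a gate diagonal in the magic basis, anti-degradability at one eigenstate of each Pauli
matrix already forces it at every environment state: at such an eigenstate only one term of
`orientation_magicDiag` survives, and a local permutation of the magic basis moves it to the
eigenstate `|0⟩` of `σ_z`, where the isometry is in Schmidt form. -/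
theorem magicDiag_mem_univAntiDegradable_iff {d : Fin 4 → ℂ} (hd : ∀ k, ‖d k‖ = 1) :
    magicDiag d ∈ univAntiDegradable ↔
      (d 0 * star (d 1)).re * (d 2 * star (d 3)).re ≤ 0 ∧
      (d 0 * star (d 2)).re * (d 1 * star (d 3)).re ≤ 0 ∧
      (d 0 * star (d 3)).re * (d 1 * star (d 2)).re ≤ 0 := by
  constructor
  · have key : ∀ e : Fin 4 → ℂ, (∀ k, ‖e k‖ = 1) → magicDiag e ∈ univAntiDegradable →
        (e 0 * star (e 1)).re * (e 2 * star (e 3)).re ≤ 0 := by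
      intro e he h
      have hη : IsUnitKet (![1, 0] : Fin 2 → ℂ) := by
        simp [IsUnitKet, dotProduct]
      have h1 := (isAntiDegradableAt_iff _ _).1 (h.2 _ hη)
      have hW : magicDiag e * appendKet ![1, 0] =
          schmidtForm ((e 0 + e 1) / 2) ((e 0 - e 1) / 2) ((e 2 + e 3) / 2) ((e 3 - e 2) / 2) := by
        rw [magicDiag_entries]
        ext ⟨i, j⟩ a
        fin_cases i <;> fin_cases j <;> fin_cases a <;>
          simp [Matrix.mul_apply, Fintype.sum_prod_type, appendKet, schmidtForm]
      have hn : ∀ k, (e k).re ^ 2 + (e k).im ^ 2 = 1 := fun k => by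
        have := Complex.normSq_apply (e k)
        rw [Complex.normSq_eq_norm_sq, he] at this
        linarith
      have h4 : ∀ z : ℂ, Complex.normSq (z / 2) = (z.re ^ 2 + z.im ^ 2) / 4 := fun z => by
        rw [Complex.normSq_div, Complex.normSq_apply]
        norm_num
        ring
      rw [hW] at h1
      have h2 := h1.sq_le_of_schmidtForm
        (by simp only [h4, Complex.add_re, Complex.sub_re, Complex.add_im, Complex.sub_im]
            linear_combination (hn 0 + hn 1) / 2)
        (by simp only [h4, Complex.add_re, Complex.sub_re, Complex.add_im, Complex.sub_im]
            linear_combination (hn 2 + hn 3) / 2)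
      simp only [h4, Complex.add_re, Complex.sub_re, Complex.add_im, Complex.sub_im] at h2
      simp only [Complex.star_def, Complex.mul_re, Complex.conj_re, Complex.conj_im]
      have e1 : ((e 0).re + (e 1).re) ^ 2 + ((e 0).im + (e 1).im) ^ 2 =
          2 + 2 * ((e 0).re * (e 1).re + (e 0).im * (e 1).im) := by
        linear_combination hn 0 + hn 1
      have e2 : ((e 2).re + (e 3).re) ^ 2 + ((e 2).im + (e 3).im) ^ 2 =
          2 + 2 * ((e 2).re * (e 3).re + (e 2).im * (e 3).im) := by
        linear_combination hn 2 + hn 3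
      have e3 : ((e 3).re - (e 2).re) ^ 2 + ((e 3).im - (e 2).im) ^ 2 =
          2 - 2 * ((e 2).re * (e 3).re + (e 2).im * (e 3).im) := by
        linear_combination hn 2 + hn 3
      rw [e1, e2, e3] at h2
      nlinarith
    intro h
    have hc : ∀ z w : ℂ, (z * star w).re = (w * star z).re := fun z w => by
      simp only [Complex.star_def, Complex.mul_re, Complex.conj_re, Complex.conj_im]
      ring
    have h1 := (locallyEquiv_magicDiag_swap_zero_one d).symm.mem_univAntiDegradable h
    have h2 := (locallyEquiv_magicDiag_swap_one_three _).symm.mem_univAntiDegradable h1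
    have h3 := (locallyEquiv_magicDiag_swap_one_three d).symm.mem_univAntiDegradable h
    have s0 : Equiv.swap (1 : Fin 4) 3 0 = 0 := by decide
    have s2 : Equiv.swap (1 : Fin 4) 3 2 = 2 := by decide
    have t2 : Equiv.swap (0 : Fin 4) 1 2 = 2 := by decide
    have t3 : Equiv.swap (0 : Fin 4) 1 3 = 3 := by decide
    refine ⟨key d hd h, ?_, ?_⟩
    · have k2 := key _ (fun k => hd _) h2
      simp only [s0, s2, t2, t3, Equiv.swap_apply_left,
        Equiv.swap_apply_right] at k2
      rw [mul_comm, hc (d 0)]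
      exact k2
    · have k3 := key _ (fun k => hd _) h3
      simp only [s0, s2, Equiv.swap_apply_left,
        Equiv.swap_apply_right] at k3
      rw [hc (d 1)]
      exact k3
  · rintro ⟨h1, h2, h3⟩
    refine ⟨magicDiag_mem_unitaryGroup hd, fun η hη => ?_⟩
    rw [isAntiDegradableAt_iff]
    apply antiDegrades_of_orientation_nonpos
    · rw [Matrix.conjTranspose_mul, Matrix.mul_assoc, ← Matrix.mul_assoc (magicDiag d)ᴴ,
        ← Matrix.star_eq_conjTranspose (magicDiag d),
        Matrix.mem_unitaryGroup_iff'.1 (magicDiag_mem_unitaryGroup hd), Matrix.one_mul,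
        appendKet_isometry hη]
    · rw [orientation_magicDiag, Complex.ofReal_re]
      exact add_nonpos (add_nonpos (mul_nonpos_of_nonneg_of_nonpos (sq_nonneg _) h1)
        (mul_nonpos_of_nonneg_of_nonpos (sq_nonneg _) h2))
        (mul_nonpos_of_nonneg_of_nonpos (sq_nonneg _) h3)

theorem magicDiag_mem_univDegradable_iff {d : Fin 4 → ℂ} (hd : ∀ k, ‖d k‖ = 1) :
    magicDiag d ∈ univDegradable ↔
      0 ≤ (d 0 * star (d 1)).re * (d 2 * star (d 3)).re ∧
      0 ≤ (d 0 * star (d 2)).re * (d 1 * star (d 3)).re ∧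
      0 ≤ (d 0 * star (d 3)).re * (d 1 * star (d 2)).re := by
  rw [mem_univDegradable_iff, swapGate_mul_magicDiag, magicDiag_mem_univAntiDegradable_iff
    (fun k => by fin_cases k <;> simp [hd])]
  simp only [Matrix.cons_val, star_neg, mul_neg, neg_mul, Complex.neg_re, neg_nonpos]

/-! ### The square root of the swap gate -/

theorem sqrtSwap_eq_magicDiag : sqrtSwap = magicDiag ![1, 1, Complex.I, 1] := by
  have he : Complex.exp (Complex.I * Real.pi * ((1 / 2 : ℝ) : ℂ)) = Complex.I := by
    have h : Complex.I * Real.pi * ((1 / 2 : ℝ) : ℂ) = Real.pi / 2 * Complex.I := by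
      push_cast
      ring
    rw [h, Complex.exp_pi_div_two_mul_I]
  rw [sqrtSwap, swapPow, he, magicDiag_entries]
  ext ⟨i, j⟩ ⟨k, l⟩
  fin_cases i <;> fin_cases j <;> fin_cases k <;> fin_cases l <;>
    simp [swapGate] <;> ring

theorem norm_sqrtSwap_phase (k : Fin 4) : ‖(![1, 1, Complex.I, 1] : Fin 4 → ℂ) k‖ = 1 := by
  fin_cases k <;> simp

theorem sqrtSwap_mul_self : sqrtSwap * sqrtSwap = swapGate := by
  rw [sqrtSwap_eq_magicDiag, magicDiag_mul, ← Matrix.mul_one swapGate, ← magicDiag_one,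
    swapGate_mul_magicDiag]
  congr 1
  ext k
  fin_cases k <;> simp

theorem sqrtSwap_mem_inter : sqrtSwap ∈ univAntiDegradable ∩ univDegradable := by
  rw [sqrtSwap_eq_magicDiag]
  constructor
  · rw [magicDiag_mem_univAntiDegradable_iff norm_sqrtSwap_phase]
    simp
  · rw [magicDiag_mem_univDegradable_iff norm_sqrtSwap_phase]
    simp

theorem sqrtSwap_map_conj :
    sqrtSwap.map (starRingEnd ℂ) = magicDiag ![1, 1, -Complex.I, 1] := by
  rw [sqrtSwap_eq_magicDiag, magicDiag_map_conj]
  congr 1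
  ext k
  fin_cases k <;> simp

theorem sqrtSwap_map_conj_mem_inter :
    sqrtSwap.map (starRingEnd ℂ) ∈ univAntiDegradable ∩ univDegradable := by
  have h : ∀ k, ‖(![1, 1, -Complex.I, 1] : Fin 4 → ℂ) k‖ = 1 := fun k => by
    fin_cases k <;> simp
  rw [sqrtSwap_map_conj]
  constructor
  · rw [magicDiag_mem_univAntiDegradable_iff h]
    simp
  · rw [magicDiag_mem_univDegradable_iff h]
    simp

/-- Three unit complex numbers cannot be pairwise orthogonal in the real plane, so the three
orthogonal pairs, one from each pairing of the four phases, share a common member. -/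
theorem exists_forall_sq_eq_neg_sq {d : Fin 4 → ℂ} (hd : ∀ k, ‖d k‖ = 1)
    (h1 : (d 0 * star (d 1)).re * (d 2 * star (d 3)).re = 0)
    (h2 : (d 0 * star (d 2)).re * (d 1 * star (d 3)).re = 0)
    (h3 : (d 0 * star (d 3)).re * (d 1 * star (d 2)).re = 0) :
    ∃ k, ∀ j, j ≠ k → d j ^ 2 = -d k ^ 2 := by
  have hn : ∀ k, d k * star (d k) = 1 := fun k => by
    rw [Complex.star_def, Complex.mul_conj, Complex.normSq_eq_norm_sq, hd]
    norm_num
  have key : ∀ i j, (d i * star (d j)).re = 0 → d i ^ 2 = -d j ^ 2 := fun i j h => by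
    have h' : d i * star (d j) + star (d i) * d j = 0 := by
      have := Complex.add_conj (d i * star (d j))
      rw [h] at this
      simpa using this
    linear_combination d i * d j * h' - d i ^ 2 * hn j - d j ^ 2 * hn i
  have hne : ∀ k, d k ^ 2 ≠ 0 := fun k => pow_ne_zero 2 fun h => by
    have := hd k
    rw [h, norm_zero] at this
    exact zero_ne_one this
  have tri : ∀ i j k, d i ^ 2 = -d j ^ 2 → d i ^ 2 = -d k ^ 2 → d j ^ 2 = -d k ^ 2 → False := by
    intro i j k hij hik hjk
    apply hne j
    linear_combination (hij - hik + hjk) * (1 / 2 : ℂ)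
  rcases mul_eq_zero.1 h1 with a | a <;> rcases mul_eq_zero.1 h2 with b | b <;>
    rcases mul_eq_zero.1 h3 with c | c <;> have a := key _ _ a <;> have b := key _ _ b <;>
    have c := key _ _ c
  · exact ⟨0, fun j hj => by
      fin_cases j
      · exact absurd rfl hj
      · exact (neg_eq_iff_eq_neg.2 a).symm
      · exact (neg_eq_iff_eq_neg.2 b).symm
      · exact (neg_eq_iff_eq_neg.2 c).symm⟩
  · exact (tri _ _ _ a b c).elim
  · exact (tri _ _ _ a c b).elim
  · exact ⟨1, fun j hj => by
      fin_cases j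
      · exact a
      · exact absurd rfl hj
      · exact (neg_eq_iff_eq_neg.2 c).symm
      · exact (neg_eq_iff_eq_neg.2 b).symm⟩
  · exact (tri _ _ _ b c a).elim
  · exact ⟨2, fun j hj => by
      fin_cases j
      · exact b
      · exact c
      · exact absurd rfl hj
      · exact (neg_eq_iff_eq_neg.2 a).symm⟩
  · exact ⟨3, fun j hj => by
      fin_cases j
      · exact c
      · exact b
      · exact a
      · exact absurd rfl hj⟩
  · exact (tri _ _ _ c b a).elim

/-- A magic-diagonal gate one of whose eigenvalues is `±i` times each of the others is locally
equivalent to `√SWAP` or its complex conjugate. -/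
theorem gateEquiv_sqrtSwap_of_sq_eq_neg_sq {d : Fin 4 → ℂ} (hd : ∀ k, ‖d k‖ = 1)
    (h0 : d 0 ^ 2 = -d 2 ^ 2) (h1 : d 1 ^ 2 = -d 2 ^ 2) (h3 : d 3 ^ 2 = -d 2 ^ 2) :
    GateEquiv (magicDiag d) sqrtSwap := by
  have e1 : d 1 = d 0 ∨ d 1 = -d 0 := sq_eq_sq_iff_eq_or_eq_neg.1 (h1.trans h0.symm)
  have e3 : d 3 = d 0 ∨ d 3 = -d 0 := sq_eq_sq_iff_eq_or_eq_neg.1 (h3.trans h0.symm)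
  have e2 : d 2 = Complex.I * d 0 ∨ d 2 = -(Complex.I * d 0) := by
    apply sq_eq_sq_iff_eq_or_eq_neg.1
    rw [mul_pow, Complex.I_sq, h0]
    ring
  -- Adjust the signs of the second and fourth eigenvalue by `σ_x ⊗ σ_x` and `σ_z ⊗ σ_z`.
  obtain ⟨e, he, hde⟩ : ∃ e : Fin 4 → ℂ, (e 0 = d 0 ∧ e 1 = d 0 ∧ (e 2 = d 2 ∨ e 2 = -d 2) ∧
      (e 3 = d 3)) ∧ LocallyEquiv (magicDiag d) (magicDiag e) := by
    rcases e1 with e1 | e1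
    · exact ⟨d, ⟨rfl, e1, Or.inl rfl, rfl⟩, LocallyEquiv.refl _⟩
    · exact ⟨![d 0, -d 1, -d 2, d 3], ⟨rfl, by simp [e1], Or.inr rfl, rfl⟩,
        locallyEquiv_magicDiag_xx d⟩
  obtain ⟨g0, g1, g2, g3⟩ := he
  obtain ⟨f, ⟨f0, f1, f2, f3⟩, hdf⟩ : ∃ f : Fin 4 → ℂ, (f 0 = d 0 ∧ f 1 = d 0 ∧
      (f 2 = d 2 ∨ f 2 = -d 2) ∧ f 3 = d 0) ∧ LocallyEquiv (magicDiag e) (magicDiag f) := by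
    rcases e3 with e3 | e3
    · exact ⟨e, ⟨g0, g1, g2, g3.trans e3⟩, LocallyEquiv.refl _⟩
    · refine ⟨![e 0, e 1, -e 2, -e 3], ⟨g0, g1, ?_, ?_⟩, locallyEquiv_magicDiag_zz e⟩
      · rcases g2 with h | h <;> simp [h]
      · simp [g3, e3]
  have hs : f = d 0 • ![1, 1, Complex.I, 1] ∨ f = d 0 • ![1, 1, -Complex.I, 1] := by
    have h2 : f 2 = Complex.I * d 0 ∨ f 2 = -(Complex.I * d 0) := by
      rcases f2 with h | h <;> rcases e2 with h' | h' <;> simp [h, h']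
    rcases h2 with h2 | h2
    · left
      ext k
      fin_cases k <;> simp [f0, f1, f3, h2, mul_comm]
    · right
      ext k
      fin_cases k <;> simp [f0, f1, f3, h2, mul_comm]
  rw [GateEquiv, sqrtSwap_map_conj, sqrtSwap_eq_magicDiag]
  refine hs.imp (fun h => ?_) fun h => ?_ <;>
  · rw [h, magicDiag_smul] at hdf
    exact (hde.trans hdf).trans (locallyEquiv_smul (hd 0) _)

theorem mem_inter_iff_gateEquiv_sqrtSwap (V : TwoQubitOp) :
    V ∈ univAntiDegradable ∩ univDegradable ↔ GateEquiv V sqrtSwap := by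
  constructor
  · rintro ⟨hA, hD⟩
    obtain ⟨d, hd, h⟩ := exists_locallyEquiv_magicDiag hA.1
    obtain ⟨a1, a2, a3⟩ := (magicDiag_mem_univAntiDegradable_iff hd).1
      (h.symm.mem_univAntiDegradable hA)
    obtain ⟨b1, b2, b3⟩ := (magicDiag_mem_univDegradable_iff hd).1
      (h.symm.mem_univDegradable hD)
    obtain ⟨k, hk⟩ := exists_forall_sq_eq_neg_sq hd (le_antisymm a1 b1) (le_antisymm a2 b2)
      (le_antisymm a3 b3)
    have key : ∀ e : Fin 4 → ℂ, (∀ k, ‖e k‖ = 1) → (∀ j, j ≠ 2 → e j ^ 2 = -e 2 ^ 2) →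
        LocallyEquiv V (magicDiag e) → GateEquiv V sqrtSwap := fun e he h2 hVe =>
      (gateEquiv_sqrtSwap_of_sq_eq_neg_sq he (h2 0 (by decide)) (h2 1 (by decide))
        (h2 3 (by decide))).imp hVe.trans hVe.trans
    -- Permute the exceptional eigenvalue to the singlet.
    have hstep : ∀ (e : Fin 4 → ℂ) (σ : Equiv.Perm (Fin 4)) (k k' : Fin 4), σ k' = k →
        (∀ j, j ≠ k → e j ^ 2 = -e k ^ 2) → ∀ j, j ≠ k' → (e ∘ ⇑σ) j ^ 2 = -(e ∘ ⇑σ) k' ^ 2 := by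
      rintro e σ k k' rfl he j hj
      exact he _ fun h => hj (σ.injective h)
    have key3 : ∀ e : Fin 4 → ℂ, (∀ k, ‖e k‖ = 1) → (∀ j, j ≠ 3 → e j ^ 2 = -e 3 ^ 2) →
        LocallyEquiv V (magicDiag e) → GateEquiv V sqrtSwap := fun e he h3 hVe =>
      key (e ∘ ⇑(Equiv.swap (2 : Fin 4) 3)) (fun _ => he _)
        (hstep e (Equiv.swap 2 3) 3 2 (by decide) h3)
        (hVe.trans (locallyEquiv_magicDiag_swap_two_three e))
    have key1 : ∀ e : Fin 4 → ℂ, (∀ k, ‖e k‖ = 1) → (∀ j, j ≠ 1 → e j ^ 2 = -e 1 ^ 2) →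
        LocallyEquiv V (magicDiag e) → GateEquiv V sqrtSwap := fun e he h1 hVe =>
      key3 (e ∘ ⇑(Equiv.swap (1 : Fin 4) 3)) (fun _ => he _)
        (hstep e (Equiv.swap 1 3) 1 3 (by decide) h1)
        (hVe.trans (locallyEquiv_magicDiag_swap_one_three e))
    have hk' : k = 0 ∨ k = 1 ∨ k = 2 ∨ k = 3 := by omega
    rcases hk' with rfl | rfl | rfl | rfl
    · exact key1 (d ∘ ⇑(Equiv.swap (0 : Fin 4) 1)) (fun _ => hd _)
        (hstep d (Equiv.swap 0 1) 0 1 (by decide) hk)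
        (h.trans (locallyEquiv_magicDiag_swap_zero_one d))
    · exact key1 d hd hk h
    · exact key d hd hk h
    · exact key3 d hd hk h
  · rintro (h | h)
    · exact ⟨h.mem_univAntiDegradable sqrtSwap_mem_inter.1,
        h.mem_univDegradable sqrtSwap_mem_inter.2⟩
    · exact ⟨h.mem_univAntiDegradable sqrtSwap_map_conj_mem_inter.1,
        h.mem_univDegradable sqrtSwap_map_conj_mem_inter.2⟩

/-! ### The parameter regions -/

theorem canonicalU_eq (α : Fin 3 → ℝ) :
    canonicalU α = magicDiag fun k => Complex.exp (-Complex.I * (magicPhase α k : ℂ)) := rfl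

theorem norm_exp_neg_I_mul (x : ℝ) : ‖Complex.exp (-Complex.I * (x : ℂ))‖ = 1 := by
  rw [show -Complex.I * (x : ℂ) = ((-x : ℝ) : ℂ) * Complex.I by push_cast; ring]
  exact Complex.norm_exp_ofReal_mul_I _

theorem exp_mul_star_exp_re (x y : ℝ) :
    (Complex.exp (-Complex.I * (x : ℂ)) * star (Complex.exp (-Complex.I * (y : ℂ)))).re =
      Real.cos (x - y) := by
  rw [Complex.star_def, ← Complex.exp_conj, ← Complex.exp_add,
    ← Complex.exp_ofReal_mul_I_re, ← Complex.conj_re, ← Complex.exp_conj]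
  congr 2
  simp
  ring

theorem magicPhase_sub (α : Fin 3 → ℝ) :
    magicPhase α 0 - magicPhase α 1 = α 0 - α 1 ∧ magicPhase α 2 - magicPhase α 3 = -(α 0 + α 1) ∧
    magicPhase α 0 - magicPhase α 2 = α 0 + α 2 ∧ magicPhase α 1 - magicPhase α 3 = -(α 0 - α 2) ∧
    magicPhase α 0 - magicPhase α 3 = -(α 1 - α 2) ∧
    magicPhase α 1 - magicPhase α 2 = α 1 + α 2 := by
  simp only [magicPhase, Matrix.cons_val]
  refine ⟨?_, ?_, ?_, ?_, ?_, ?_⟩ <;> ring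

theorem canonicalU_mem_univAntiDegradable_iff_cos (α : Fin 3 → ℝ) :
    canonicalU α ∈ univAntiDegradable ↔
      Real.cos (α 0 - α 1) * Real.cos (α 0 + α 1) ≤ 0 ∧
      Real.cos (α 0 + α 2) * Real.cos (α 0 - α 2) ≤ 0 ∧
      Real.cos (α 1 - α 2) * Real.cos (α 1 + α 2) ≤ 0 := by
  rw [canonicalU_eq, magicDiag_mem_univAntiDegradable_iff fun k => norm_exp_neg_I_mul _]
  obtain ⟨h01, h23, h02, h13, h03, h12⟩ := magicPhase_sub α
  simp only [exp_mul_star_exp_re, h01, h23, h02, h13, h03, h12, Real.cos_neg]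

theorem canonicalU_mem_univDegradable_iff_cos (α : Fin 3 → ℝ) :
    canonicalU α ∈ univDegradable ↔
      0 ≤ Real.cos (α 0 - α 1) * Real.cos (α 0 + α 1) ∧
      0 ≤ Real.cos (α 0 + α 2) * Real.cos (α 0 - α 2) ∧
      0 ≤ Real.cos (α 1 - α 2) * Real.cos (α 1 + α 2) := by
  rw [canonicalU_eq, magicDiag_mem_univDegradable_iff fun k => norm_exp_neg_I_mul _]
  obtain ⟨h01, h23, h02, h13, h03, h12⟩ := magicPhase_sub α
  simp only [exp_mul_star_exp_re, h01, h23, h02, h13, h03, h12, Real.cos_neg]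

theorem cos_sub_mul_cos_add_nonpos_iff {x y : ℝ} (hx : x ≤ Real.pi / 2) (hxy : y ≤ x)
    (hy : 0 ≤ y) : Real.cos (x - y) * Real.cos (x + y) ≤ 0 ↔ Real.pi / 2 ≤ x + y := by
  constructor
  · intro h
    by_contra! hlt
    have h1 : 0 < Real.cos (x - y) := Real.cos_pos_of_mem_Ioo ⟨by linarith, by linarith⟩
    have h2 : 0 < Real.cos (x + y) := Real.cos_pos_of_mem_Ioo ⟨by linarith, hlt⟩
    exact absurd h (not_le.2 (mul_pos h1 h2))
  · intro h
    exact mul_nonpos_of_nonneg_of_nonpos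
      (Real.cos_nonneg_of_mem_Icc ⟨by linarith, by linarith⟩)
      (Real.cos_nonpos_of_pi_div_two_le_of_le h (by linarith))

/-- The reflection `x ↦ π/2 - y`, `y ↦ π/2 - x` turns this into the nonpositive case. -/
theorem zero_le_cos_sub_mul_cos_add_iff {x y : ℝ} (hx : x ≤ Real.pi / 2) (hxy : y ≤ x)
    (hy : 0 ≤ y) : 0 ≤ Real.cos (x - y) * Real.cos (x + y) ↔ x + y ≤ Real.pi / 2 := by
  have h := cos_sub_mul_cos_add_nonpos_iff (x := Real.pi / 2 - y) (y := Real.pi / 2 - x)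
    (by linarith) (by linarith) (by linarith)
  rw [show Real.pi / 2 - y - (Real.pi / 2 - x) = x - y by ring,
    show Real.pi / 2 - y + (Real.pi / 2 - x) = Real.pi - (x + y) by ring, Real.cos_pi_sub, mul_neg,
    neg_nonpos] at h
  rw [h]
  constructor <;> intro h <;> linarith

theorem canonicalU_mem_univAntiDegradable_iff {α : Fin 3 → ℝ} (hα : α ∈ paramTetrahedron) :
    canonicalU α ∈ univAntiDegradable ↔
      Real.pi / 2 ≤ α 0 + α 1 ∧ Real.pi / 2 ≤ α 1 + α 2 ∧ Real.pi / 2 ≤ α 2 + α 0 := by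
  obtain ⟨h0, h1, h2, h3⟩ := hα
  rw [canonicalU_mem_univAntiDegradable_iff_cos,
    cos_sub_mul_cos_add_nonpos_iff h0 h1 (h3.trans h2), mul_comm (Real.cos (α 0 + α 2)),
    cos_sub_mul_cos_add_nonpos_iff h0 (h2.trans h1) h3,
    cos_sub_mul_cos_add_nonpos_iff (h1.trans h0) h2 h3, add_comm (α 2)]
  tauto

theorem canonicalU_mem_univDegradable_iff {α : Fin 3 → ℝ} (hα : α ∈ paramTetrahedron) :
    canonicalU α ∈ univDegradable ↔
      α 0 + α 1 ≤ Real.pi / 2 ∧ α 1 + α 2 ≤ Real.pi / 2 ∧ α 2 + α 0 ≤ Real.pi / 2 := by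
  obtain ⟨h0, h1, h2, h3⟩ := hα
  rw [canonicalU_mem_univDegradable_iff_cos,
    zero_le_cos_sub_mul_cos_add_iff h0 h1 (h3.trans h2), mul_comm (Real.cos (α 0 + α 2)),
    zero_le_cos_sub_mul_cos_add_iff h0 (h2.trans h1) h3,
    zero_le_cos_sub_mul_cos_add_iff (h1.trans h0) h2 h3, add_comm (α 2)]
  tauto

theorem swapParams_mem_paramTetrahedron {α : Fin 3 → ℝ} (hα : α ∈ paramTetrahedron) :
    swapParams α ∈ paramTetrahedron := by
  obtain ⟨h0, h1, h2, h3⟩ := hα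
  simp only [paramTetrahedron, swapParams, Set.mem_ofPred_eq, Matrix.cons_val]
  refine ⟨?_, ?_, ?_, ?_⟩ <;> linarith

theorem swapParams_swapParams (α : Fin 3 → ℝ) : swapParams (swapParams α) = α := by
  ext k
  fin_cases k <;> simp [swapParams]

theorem swapParams_antiVertices (i : Fin 4) : swapParams (antiVertices i) = degVertices i := by
  ext k
  fin_cases i <;> fin_cases k <;> simp [swapParams, antiVertices, degVertices] <;> ring

theorem paramRegion_univAntiDegradable :
    paramRegion univAntiDegradable =
      {α | α 0 ≤ Real.pi / 2 ∧ α 1 ≤ α 0 ∧ α 2 ≤ α 1 ∧ Real.pi / 2 ≤ α 1 + α 2} := by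
  ext α
  simp only [paramRegion, Set.mem_ofPred_eq]
  constructor
  · rintro ⟨hα, h⟩
    rw [canonicalU_mem_univAntiDegradable_iff hα] at h
    exact ⟨hα.1, hα.2.1, hα.2.2.1, h.2.1⟩
  · rintro ⟨h0, h1, h2, h3⟩
    have hα : α ∈ paramTetrahedron := ⟨h0, h1, h2, by linarith⟩
    refine ⟨hα, (canonicalU_mem_univAntiDegradable_iff hα).2 ⟨?_, ?_, ?_⟩⟩ <;> linarith

theorem paramRegion_univDegradable :
    paramRegion univDegradable =
      {α | α 0 + α 1 ≤ Real.pi / 2 ∧ α 1 ≤ α 0 ∧ α 2 ≤ α 1 ∧ 0 ≤ α 2} := by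
  ext α
  simp only [paramRegion, Set.mem_ofPred_eq]
  constructor
  · rintro ⟨hα, h⟩
    rw [canonicalU_mem_univDegradable_iff hα] at h
    exact ⟨h.1, hα.2⟩
  · rintro ⟨h0, h1, h2, h3⟩
    have hα : α ∈ paramTetrahedron := ⟨by linarith, h1, h2, h3⟩
    refine ⟨hα, (canonicalU_mem_univDegradable_iff hα).2 ⟨?_, ?_, ?_⟩⟩ <;> linarith

theorem image_swapParams_paramRegion :
    swapParams '' paramRegion univAntiDegradable = paramRegion univDegradable := by
  rw [paramRegion_univAntiDegradable, paramRegion_univDegradable]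
  ext α
  constructor
  · rintro ⟨β, ⟨h0, h1, h2, h3⟩, rfl⟩
    simp only [swapParams, Set.mem_ofPred_eq, Matrix.cons_val]
    refine ⟨?_, ?_, ?_, ?_⟩ <;> linarith
  · rintro ⟨h0, h1, h2, h3⟩
    refine ⟨swapParams α, ?_, swapParams_swapParams α⟩
    simp only [swapParams, Set.mem_ofPred_eq, Matrix.cons_val]
    refine ⟨?_, ?_, ?_, ?_⟩ <;> linarith

theorem mem_convexHull_range_four {v : Fin 4 → Fin 3 → ℝ} (w : Fin 4 → ℝ) (hw : ∀ i, 0 ≤ w i)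
    (hs : ∑ i, w i = 1) : ∑ i, w i • v i ∈ convexHull ℝ (Set.range v) :=
  (convex_convexHull ℝ _).sum_mem (fun i _ => hw i) hs fun i _ =>
    subset_convexHull ℝ _ (Set.mem_range_self i)

theorem paramRegion_univAntiDegradable_eq_convexHull :
    paramRegion univAntiDegradable = convexHull ℝ (Set.range antiVertices) := by
  have hpi := Real.pi_pos
  rw [paramRegion_univAntiDegradable]
  apply Set.Subset.antisymm
  · rintro α ⟨h0, h1, h2, h3⟩
    -- The weights are the barycentric coordinates of `α`.
    convert mem_convexHull_range_four (v := antiVertices)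
      ![2 - 4 / Real.pi * α 0, 4 / Real.pi * (α 0 - α 1), 2 / Real.pi * (α 1 - α 2),
        2 / Real.pi * (α 1 + α 2) - 1] (fun i => ?_) ?_ using 1
    · ext k
      fin_cases k <;> simp [Fin.sum_univ_four, antiVertices] <;> field_simp <;> ring
    · have h4 : 4 / Real.pi * α 0 ≤ 2 := by
        rw [div_mul_eq_mul_div, div_le_iff₀ hpi]
        linarith
      have h5 : 1 ≤ 2 / Real.pi * (α 1 + α 2) := by
        rw [div_mul_eq_mul_div, le_div_iff₀ hpi]
        linarith
      fin_cases i
      · exact sub_nonneg.2 h4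
      · exact mul_nonneg (by positivity) (sub_nonneg.2 h1)
      · exact mul_nonneg (by positivity) (sub_nonneg.2 h2)
      · exact sub_nonneg.2 h5
    · simp [Fin.sum_univ_four]
      ring
  · refine convexHull_min ?_ ?_
    · rintro _ ⟨i, rfl⟩
      fin_cases i <;> simp [antiVertices] <;> (repeat' constructor) <;> linarith
    · rintro x ⟨x0, x1, x2, x3⟩ y ⟨y0, y1, y2, y3⟩ a b ha hb hab
      obtain rfl : b = 1 - a := by linarith
      simp only [Set.mem_ofPred_eq, Pi.add_apply, Pi.smul_apply, smul_eq_mul]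
      refine ⟨?_, ?_, ?_, ?_⟩
      · linarith [mul_le_mul_of_nonneg_left x0 ha, mul_le_mul_of_nonneg_left y0 hb]
      · linarith [mul_le_mul_of_nonneg_left x1 ha, mul_le_mul_of_nonneg_left y1 hb]
      · linarith [mul_le_mul_of_nonneg_left x2 ha, mul_le_mul_of_nonneg_left y2 hb]
      · linarith [mul_le_mul_of_nonneg_left x3 ha, mul_le_mul_of_nonneg_left y3 hb]

theorem paramRegion_univDegradable_eq_convexHull :
    paramRegion univDegradable = convexHull ℝ (Set.range degVertices) := by
  have hpi := Real.pi_pos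
  rw [paramRegion_univDegradable]
  apply Set.Subset.antisymm
  · rintro α ⟨h0, h1, h2, h3⟩
    -- The weights are the barycentric coordinates of `α`.
    convert mem_convexHull_range_four (v := degVertices)
      ![4 / Real.pi * α 2, 4 / Real.pi * (α 1 - α 2), 2 / Real.pi * (α 0 - α 1),
        1 - 2 / Real.pi * (α 0 + α 1)] (fun i => ?_) ?_ using 1
    · ext k
      fin_cases k <;> simp [Fin.sum_univ_four, degVertices] <;> field_simp <;> ring
    · have h4 : 2 / Real.pi * (α 0 + α 1) ≤ 1 := by
        rw [div_mul_eq_mul_div, div_le_iff₀ hpi]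
        linarith
      fin_cases i
      · exact mul_nonneg (by positivity) h3
      · exact mul_nonneg (by positivity) (sub_nonneg.2 h2)
      · exact mul_nonneg (by positivity) (sub_nonneg.2 h1)
      · exact sub_nonneg.2 h4
    · simp [Fin.sum_univ_four]
      ring
  · refine convexHull_min ?_ ?_
    · rintro _ ⟨i, rfl⟩
      fin_cases i <;> simp [degVertices] <;> (repeat' constructor) <;> linarith
    · rintro x ⟨x0, x1, x2, x3⟩ y ⟨y0, y1, y2, y3⟩ a b ha hb hab
      obtain rfl : b = 1 - a := by linarith
      simp only [Set.mem_ofPred_eq, Pi.add_apply, Pi.smul_apply, smul_eq_mul]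
      refine ⟨?_, ?_, ?_, ?_⟩
      · linarith [mul_le_mul_of_nonneg_left x0 ha, mul_le_mul_of_nonneg_left y0 hb]
      · linarith [mul_le_mul_of_nonneg_left x1 ha, mul_le_mul_of_nonneg_left y1 hb]
      · linarith [mul_le_mul_of_nonneg_left x2 ha, mul_le_mul_of_nonneg_left y2 hb]
      · linarith [mul_nonneg ha x3, mul_nonneg hb y3]

theorem affineIndependent_antiVertices : AffineIndependent ℝ antiVertices := by
  rw [affineIndependent_iff_of_fintype]
  intro w hw h
  rw [Finset.weightedVSub_eq_linear_combination _ hw] at h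
  have e0 := congrFun h 0
  have e1 := congrFun h 1
  have e2 := congrFun h 2
  simp [Fin.sum_univ_four, antiVertices] at e0 e1 e2 hw
  intro i
  refine (mul_eq_zero.1 (?_ : Real.pi * w i = 0)).resolve_left Real.pi_ne_zero
  fin_cases i <;> simp only [Fin.zero_eta, Fin.mk_one, Fin.reduceFinMk]
  · linear_combination 2 * Real.pi * hw - 4 * e0
  · linear_combination 4 * e0 - 4 * e1
  · linear_combination 2 * e1 - 2 * e2
  · linear_combination 2 * e1 + 2 * e2 - Real.pi * hw

theorem affineIndependent_degVertices : AffineIndependent ℝ degVertices := by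
  rw [affineIndependent_iff_of_fintype]
  intro w hw h
  rw [Finset.weightedVSub_eq_linear_combination _ hw] at h
  have e0 := congrFun h 0
  have e1 := congrFun h 1
  have e2 := congrFun h 2
  simp [Fin.sum_univ_four, degVertices] at e1 hw
  simp [Fin.sum_univ_four, degVertices, -mul_eq_zero] at e0 e2
  intro i
  refine (mul_eq_zero.1 (?_ : Real.pi * w i = 0)).resolve_left Real.pi_ne_zero
  fin_cases i <;> simp only [Fin.zero_eta, Fin.mk_one, Fin.reduceFinMk]
  · linear_combination 4 * e2
  · linear_combination 4 * e1 - 4 * e2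
  · linear_combination 2 * e0 - 2 * e1
  · linear_combination Real.pi * hw - 2 * e0 - 2 * e1

/-- The equivalence is complex conjugation, the exchange of `Φ₂` and `Φ₄` by `H ⊗ H`, and the phase
`exp (i π / 4)`. -/
theorem gateEquiv_swapGate_mul_canonicalU (α : Fin 3 → ℝ) :
    GateEquiv (swapGate * canonicalU α) (canonicalU (swapParams α)) := by
  right
  rw [canonicalU_eq, canonicalU_eq, swapGate_mul_magicDiag, magicDiag_map_conj]
  have h := locallyEquiv_magicDiag_swap_one_three ![Complex.exp (-Complex.I * (magicPhase α 0 : ℂ)),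
    Complex.exp (-Complex.I * (magicPhase α 1 : ℂ)),
    -Complex.exp (-Complex.I * (magicPhase α 2 : ℂ)),
    Complex.exp (-Complex.I * (magicPhase α 3 : ℂ))]
  refine h.trans ?_
  have he : (star fun k => Complex.exp (-Complex.I * (magicPhase (swapParams α) k : ℂ))) =
      Complex.exp (((Real.pi / 4 : ℝ) : ℂ) * Complex.I) •
        (![Complex.exp (-Complex.I * (magicPhase α 0 : ℂ)),
          Complex.exp (-Complex.I * (magicPhase α 1 : ℂ)),
          -Complex.exp (-Complex.I * (magicPhase α 2 : ℂ)),
          Complex.exp (-Complex.I * (magicPhase α 3 : ℂ))] ∘ Equiv.swap 1 3) := by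
    have hc : ∀ x : ℝ, star (Complex.exp (-Complex.I * (x : ℂ))) =
        Complex.exp (Complex.I * (x : ℂ)) := fun x => by
      rw [Complex.star_def, ← Complex.exp_conj]
      simp
    have hm : ∀ z : ℂ, -Complex.exp z = Complex.exp (z - Real.pi * Complex.I) := fun z => by
      rw [Complex.exp_sub, Complex.exp_pi_mul_I]
      ring
    have p0 : magicPhase (swapParams α) 0 = Real.pi / 4 - magicPhase α 0 := by
      simp [magicPhase, swapParams]; ring
    have p1 : magicPhase (swapParams α) 1 = Real.pi / 4 - magicPhase α 3 := by
      simp [magicPhase, swapParams]; ring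
    have p2 : magicPhase (swapParams α) 2 = -3 * Real.pi / 4 - magicPhase α 2 := by
      simp [magicPhase, swapParams]; ring
    have p3 : magicPhase (swapParams α) 3 = Real.pi / 4 - magicPhase α 1 := by
      simp [magicPhase, swapParams]; ring
    ext k
    fin_cases k
    · change star (Complex.exp (-Complex.I * (magicPhase (swapParams α) 0 : ℂ))) =
        _ * Complex.exp (-Complex.I * (magicPhase α 0 : ℂ))
      rw [hc, p0, ← Complex.exp_add]
      congr 1
      push_cast
      ring
    · change star (Complex.exp (-Complex.I * (magicPhase (swapParams α) 1 : ℂ))) =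
        _ * Complex.exp (-Complex.I * (magicPhase α 3 : ℂ))
      rw [hc, p1, ← Complex.exp_add]
      congr 1
      push_cast
      ring
    · change star (Complex.exp (-Complex.I * (magicPhase (swapParams α) 2 : ℂ))) =
        _ * -Complex.exp (-Complex.I * (magicPhase α 2 : ℂ))
      rw [hc, p2, hm, ← Complex.exp_add]
      congr 1
      push_cast
      ring
    · change star (Complex.exp (-Complex.I * (magicPhase (swapParams α) 3 : ℂ))) =
        _ * Complex.exp (-Complex.I * (magicPhase α 1 : ℂ))
      rw [hc, p3, ← Complex.exp_add]
      congr 1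
      push_cast
      ring
  rw [he, magicDiag_smul]
  exact (locallyEquiv_smul (Complex.norm_exp_ofReal_mul_I _) _).symm

theorem exists_canonicalU_eq_smul_sqrtSwap :
    ∃ c : ℂ, ‖c‖ = 1 ∧
      canonicalU ![Real.pi / 4, Real.pi / 4, Real.pi / 4] = c • sqrtSwap := by
  refine ⟨Complex.exp (((-(Real.pi / 8) : ℝ) : ℂ) * Complex.I),
    Complex.norm_exp_ofReal_mul_I _, ?_⟩
  rw [canonicalU_eq, sqrtSwap_eq_magicDiag, ← magicDiag_smul]
  congr 1
  ext k
  have p : magicPhase ![Real.pi / 4, Real.pi / 4, Real.pi / 4] =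
      ![Real.pi / 8, Real.pi / 8, -(3 * Real.pi / 8), Real.pi / 8] := by
    ext j
    fin_cases j <;> simp [magicPhase] <;> ring
  have h0 : Complex.exp (-Complex.I * ((Real.pi / 8 : ℝ) : ℂ)) =
      Complex.exp (((-(Real.pi / 8) : ℝ) : ℂ) * Complex.I) * 1 := by
    rw [mul_one]
    congr 1
    push_cast
    ring
  have h2 : Complex.exp (-Complex.I * ((-(3 * Real.pi / 8) : ℝ) : ℂ)) =
      Complex.exp (((-(Real.pi / 8) : ℝ) : ℂ) * Complex.I) * Complex.I := by
    refine Eq.trans ?_ (congrArg _ Complex.exp_pi_div_two_mul_I)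
    rw [← Complex.exp_add]
    congr 1
    push_cast
    ring
  rw [p]
  fin_cases k
  · exact h0
  · exact h0
  · exact h2
  · exact h0

theorem paramRegion_inter :
    paramRegion univAntiDegradable ∩ paramRegion univDegradable =
      {![Real.pi / 4, Real.pi / 4, Real.pi / 4]} := by
  rw [paramRegion_univAntiDegradable, paramRegion_univDegradable]
  ext α
  constructor
  · rintro ⟨⟨h0, h1, h2, h3⟩, h4, -, -, h5⟩
    ext k
    fin_cases k <;> simp <;> linarith
  · rintro rfl
    have hpi := Real.pi_pos
    simp
    refine ⟨⟨?_, ?_⟩, ?_, ?_⟩ <;> linarith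

end

theorem mainTheorem7 :
    -- the anti-degradable region, and that it is a tetrahedron
    (∀ α ∈ paramTetrahedron,
      (canonicalU α ∈ univAntiDegradable ↔
        Real.pi / 2 ≤ α 0 + α 1 ∧ Real.pi / 2 ≤ α 1 + α 2 ∧ Real.pi / 2 ≤ α 2 + α 0)) ∧
    AffineIndependent ℝ antiVertices ∧
    paramRegion univAntiDegradable = convexHull ℝ (Set.range antiVertices) ∧
    -- swapping the outputs exchanges the two sets of unitaries
    (fun V : TwoQubitOp => swapGate * V) '' univAntiDegradable = univDegradable ∧
    -- and acts on the parameters, taking the one region to the other, vertex by vertex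
    (∀ α ∈ paramTetrahedron, swapParams α ∈ paramTetrahedron ∧
      GateEquiv (swapGate * canonicalU α) (canonicalU (swapParams α))) ∧
    (∀ i, swapParams (antiVertices i) = degVertices i) ∧
    swapParams '' paramRegion univAntiDegradable = paramRegion univDegradable ∧
    AffineIndependent ℝ degVertices ∧
    paramRegion univDegradable = convexHull ℝ (Set.range degVertices) ∧
    -- the square root of SWAP is the only common point of the two regions
    paramRegion univAntiDegradable ∩ paramRegion univDegradable =
      {![Real.pi / 4, Real.pi / 4, Real.pi / 4]} ∧
    sqrtSwap * sqrtSwap = swapGate ∧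
    (∃ c : ℂ, ‖c‖ = 1 ∧
      canonicalU ![Real.pi / 4, Real.pi / 4, Real.pi / 4] = c • sqrtSwap) ∧
    sqrtSwap ∈ univAntiDegradable ∩ univDegradable ∧
    (∀ V : TwoQubitOp, V ∈ univAntiDegradable ∩ univDegradable ↔ GateEquiv V sqrtSwap) ∧
    -- and it induces symmetric channels
    (∀ η : Fin 2 → ℂ, IsUnitKet η → IsSymmetricAt sqrtSwap η) :=
  ⟨fun _ hα => canonicalU_mem_univAntiDegradable_iff hα, affineIndependent_antiVertices,
    paramRegion_univAntiDegradable_eq_convexHull, image_swapGate_mul_univAntiDegradable,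
    fun α hα => ⟨swapParams_mem_paramTetrahedron hα, gateEquiv_swapGate_mul_canonicalU α⟩,
    swapParams_antiVertices, image_swapParams_paramRegion, affineIndependent_degVertices,
    paramRegion_univDegradable_eq_convexHull, paramRegion_inter, sqrtSwap_mul_self,
    exists_canonicalU_eq_smul_sqrtSwap, sqrtSwap_mem_inter, mem_inter_iff_gateEquiv_sqrtSwap,
    fun η hη => ⟨sqrtSwap_mem_inter.2.2 η hη, sqrtSwap_mem_inter.1.2 η hη⟩⟩
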